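/- Let $n\ge 1$ and let $c_0,c_1,\dots,c_{n-1}$ be complex numbers with $\bar c_0=c_0$. For given numbers $c_0,\dots,c_r$ let $$M_r=\begin{pmatrix} c_0&\bar c_1&\cdots&\bar c_r\\ c_1&c_0&\cdots&\bar c_{r-1}\\ \vdots&\vdots&\ddots&\vdots\\ c_r&c_{r-1}&\cdots&c_0\end{pmatrix}$$ be the associated Hermitian Toeplitz matrix of order $r+1$, and put $|M_{-1}|=1$. For a Hermitian matrix $A$ let $\nu(A)$ and $\pi(A)$ be the numbers of negative and positive eigenvalues of $A$, counted with multiplicity, $\rho(A)=\nu(A)+\pi(A)$ its rank, and $|A|$ its determinant. For nonnegative integers $\nu,\pi$ let ${\mathfrak P}_\nu$ (respectively ${\mathfrak P}_{\nu,\pi}$) be the set of all sequences $(c_j)_{j=0}^\infty$ of complex numbers with $\bar c_0=c_0$ such that $M_r$ has exactly $\nu$ negative eigenvalues (respectively exactly $\nu$ negative and exactly $\pi$ positive eigenvalues) for all sufficiently large $r$. An extension is a sequence $(c_j)_{j=0}^\infty$ whose first $n$ terms are the given numbers $c_0,\dots,c_{n-1}$. Write $\delta=\dim\ker M_{n-1}$.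 In what follows $\nu$ and $\pi$ without argument denote nonnegative integers. Assume $|M_{n-1}|\neq 0$. (a) There exist infinitely many extensions in ${\mathfrak P}_{\nu(M_{n-1})}$, even infinitely many in the smaller set ${\mathfrak P}_{\nu(M_{n-1}),\pi(M_{n-1})}$. (b) There exist infinitely many extensions in ${\mathfrak P}_{\nu(M_{n-1})+\nu,\;\pi(M_{n-1})+\pi}$ for all $\nu\ge 0$ and $\pi\ge 0$. Assume $|M_{n-1}|=0$ and $|M_{\rho(M_{n-1})-1}|\neq 0$. (c) There is a unique extension in ${\mathfrak P}_{\nu(M_{n-1})}$; it belongs to ${\mathfrak P}_{\nu(M_{n-1}),\pi(M_{n-1})}$. (d) There are no extensions in ${\mathfrak P}_\nu$ for $\nu(M_{n-1})<\nu<\nu(M_{n-1})+\delta$; there are no extensions in ${\mathfrak P}_{\nu,\pi}$ if $\nu(M_{n-1})<\nu<\nu(M_{n-1})+\delta$ or if $\pi(M_{n-1})<\pi<\pi(M_{n-1})+\delta$. (e) There are infinitely many extensions in ${\mathfrak P}_{\nu,\pi}$ for all pairs $(\nu,\pi)$ with $\nu\ge\nu(M_{n-1})+\delta$ and $\pi\ge\pi(M_{n-1})+\delta$.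 Assume $|M_{n-1}|=0$ and $|M_{\rho(M_{n-1})-1}|=0$. (f) There are no extensions in ${\mathfrak P}_{\nu(M_{n-1})}$. (g) There are no extensions in ${\mathfrak P}_\nu$ if $\nu<\nu(M_{n-1})+\delta$; there are no extensions in ${\mathfrak P}_{\nu,\pi}$ if $\nu<\nu(M_{n-1})+\delta$ or if $\pi<\pi(M_{n-1})+\delta$. (h) There are infinitely many extensions in ${\mathfrak P}_{\nu,\pi}$ for every pair $(\nu,\pi)$ with $\nu\ge\nu(M_{n-1})+\delta$ and $\pi\ge\pi(M_{n-1})+\delta$. -/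

import Mathlib

namespace TrigMoment

/-- The Hermitian Toeplitz matrix of order `k` attached to `c_0, …, c_{k-1}`: its `(i, j)` entry is
`c_{i-j}` for `j ≤ i` and the complex conjugate of `c_{j-i}` for `i < j`.
In the usual indexing this is `M_{k-1}`; for `k = 0` it is the empty matrix, of determinant `1`. -/
def toeplitz {k : ℕ} (c : Fin k → ℂ) : Matrix (Fin k) (Fin k) ℂ :=
  Matrix.of fun i j =>
    if j ≤ i then c ⟨(i : ℕ) - (j : ℕ), lt_of_le_of_lt (Nat.sub_le _ _) i.isLt⟩
    else star (c ⟨(j : ℕ) - (i : ℕ), lt_of_le_of_lt (Nat.sub_le _ _) j.isLt⟩)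

/-- `M_r = (c_{i-j})_{i,j=0}^r` (with `c_{-j}` the conjugate of `c_j`), a matrix of order `r + 1`,
for an infinite sequence `c_0, c_1, …`. -/
def toeplitzSeq (d : ℕ → ℂ) (r : ℕ) : Matrix (Fin (r + 1)) (Fin (r + 1)) ℂ :=
  toeplitz fun i : Fin (r + 1) => d i

/-- The leading principal submatrix of order `rank M_{n-1}` of `M_{n-1}`,
that is, `M_{ρ-1}` with `ρ = rank M_{n-1}`. -/
noncomputable def toeplitzAtRank {n : ℕ} (c : Fin n → ℂ) :
    Matrix (Fin (toeplitz c).rank) (Fin (toeplitz c).rank) ℂ :=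
  toeplitz fun i => c (Fin.castLE (toeplitz c).rank_le_height i)

/-- The number of negative real eigenvalues of a complex matrix (roots of the characteristic
polynomial, counted with multiplicity). -/
noncomputable def negIndex {k : ℕ} (A : Matrix (Fin k) (Fin k) ℂ) : ℕ :=
  A.charpoly.roots.countP fun z => z.im = 0 ∧ z.re < 0

/-- The number of positive real eigenvalues of a complex matrix (roots of the characteristic
polynomial, counted with multiplicity). -/
noncomputable def posIndex {k : ℕ} (A : Matrix (Fin k) (Fin k) ℂ) : ℕ :=
  A.charpoly.roots.countP fun z => z.im = 0 ∧ 0 < z.re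

/-- For a Hermitian matrix, `negIndex` counts the negative entries of the list of eigenvalues. -/
theorem negIndex_eq {k : ℕ} {A : Matrix (Fin k) (Fin k) ℂ} (hA : A.IsHermitian) :
    negIndex A = (Finset.univ.filter fun i => hA.eigenvalues i < 0).card := by
  rw [negIndex, hA.roots_charpoly_eq_eigenvalues, Multiset.countP_map, Finset.card_def]
  simp

/-- For a Hermitian matrix, `posIndex` counts the positive entries of the list of eigenvalues. -/
theorem posIndex_eq {k : ℕ} {A : Matrix (Fin k) (Fin k) ℂ} (hA : A.IsHermitian) :
    posIndex A = (Finset.univ.filter fun i => 0 < hA.eigenvalues i).card := by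
  rw [posIndex, hA.roots_charpoly_eq_eigenvalues, Multiset.countP_map, Finset.card_def]
  simp

/-- If `c_0` is real, the Toeplitz matrix is Hermitian. -/
theorem toeplitz_isHermitian {k : ℕ} (c : Fin k → ℂ)
    (h0 : ∀ hk : 0 < k, star (c ⟨0, hk⟩) = c ⟨0, hk⟩) : (toeplitz c).IsHermitian := by
  ext i j
  rcases lt_trichotomy i j with h | rfl | h
  · simp [toeplitz, h.le, h.not_ge]
  · simpa [toeplitz] using h0 (lt_of_le_of_lt (Nat.zero_le _) i.isLt)
  · simp [toeplitz, h.le, h.not_ge]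

/-- The dimension of the kernel of a square matrix. -/
noncomputable def dimKer {k : ℕ} (A : Matrix (Fin k) (Fin k) ℂ) : ℕ :=
  Module.finrank ℂ (LinearMap.ker A.mulVecLin)

/-- `𝔓_κ`: the sequences with `c_0` real for which `M_r` has exactly `κ` negative eigenvalues for
all sufficiently large `r`. -/
def classP (κ : ℕ) : Set (ℕ → ℂ) :=
  {d | star (d 0) = d 0 ∧ ∀ᶠ r in Filter.atTop, negIndex (toeplitzSeq d r) = κ}

/-- `𝔓_{ν,π}`: the sequences with `c_0` real for which `M_r` has exactly `ν` negative and `π`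
positive eigenvalues for all sufficiently large `r`. -/
def classP₂ (ν π : ℕ) : Set (ℕ → ℂ) :=
  {d | star (d 0) = d 0 ∧ ∀ᶠ r in Filter.atTop,
    negIndex (toeplitzSeq d r) = ν ∧ posIndex (toeplitzSeq d r) = π}

/-- The infinite sequences that extend the finite sequence `c_0, …, c_{n-1}`. -/
def extensions {n : ℕ} (c : Fin n → ℂ) : Set (ℕ → ℂ) :=
  {d | ∀ j : Fin n, d j = c j}

end TrigMoment

/-! Everything is read off the nullity `dimKer (toep d k)` as `k` grows. By interlacing, each index
rises by 0 or 1 per step, and the two indices and the nullity add up to the order. Hence a drop of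
the nullity is a drop by one and raises both indices by one, while a rise is a rise by one and
freezes both indices.

The Toeplitz structure governs the nullity. Kernel vectors are regarded as sequences on `ℤ` whose
convolution with `herm d` vanishes on `[0, k)`, so they can be shifted, and reversed with
conjugation. No nonzero space of sequences supported in a fixed finite interval is shift invariant.
This forces a nonzero nullity to change at every step (`dimKer_lt_or_lt`) and, once it drops, to go
on dropping to zero (`dimKer_decreasing_step`). Starting from nullity `δ > 0`, an extension
therefore either has a growing kernel forever, with constant inertia, or eventually gains at least
`δ` in both indices (`growing_or_le_index`).

If the minor of order equal to the rank is nonzero, the kernel contains some `p` with `p 0 ≠ 0`.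
Permanent growth then means that the extension satisfies the linear recurrence with coefficients
`p`, which has exactly one solution; any other next entry starts the shrinking. If that minor
vanishes, growth is impossible, since traced backwards it would give nullity zero at the order equal
to the rank.

At nullity zero, the Schur complement belonging to the next entry `w` is a real quadratic function
of `w` (`exists_schur_vectors`) whose relevant level sets are circles or lines
(`infinite_level_set`). A nonzero value raises the index of its sign; each of the infinitely many
zeros starts a recurrence that freezes the inertia. Combining the two gives `infinite_extensions`.
-/

namespace TrigMoment

open Matrix

/-! ### Inertia through definite subspaces -/

/-- The real part of the sesquilinear form of a matrix on the diagonal. -/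
noncomputable def formRe {k : ℕ} (A : Matrix (Fin k) (Fin k) ℂ) (x : Fin k → ℂ) : ℝ :=
  (star x ⬝ᵥ A *ᵥ x).re

/-- The number of eigenvalues with the same sign as `s`. -/
noncomputable def signIndex {k : ℕ} {A : Matrix (Fin k) (Fin k) ℂ} (hA : A.IsHermitian) (s : ℝ) :
    ℕ :=
  (Finset.univ.filter fun i => 0 < s * hA.eigenvalues i).card

theorem signIndex_one {k : ℕ} {A : Matrix (Fin k) (Fin k) ℂ} (hA : A.IsHermitian) :
    signIndex hA 1 = posIndex A := by
  simp [signIndex, posIndex_eq hA]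

theorem signIndex_neg_one {k : ℕ} {A : Matrix (Fin k) (Fin k) ℂ} (hA : A.IsHermitian) :
    signIndex hA (-1) = negIndex A := by
  simp [signIndex, negIndex_eq hA]

theorem rank_add_dimKer {k : ℕ} (A : Matrix (Fin k) (Fin k) ℂ) : A.rank + dimKer A = k := by
  have := LinearMap.finrank_range_add_finrank_ker A.mulVecLin
  simpa [Matrix.rank, dimKer] using this

theorem negIndex_add_posIndex_eq_rank {k : ℕ} {A : Matrix (Fin k) (Fin k) ℂ}
    (hA : A.IsHermitian) : negIndex A + posIndex A = A.rank := by
  classical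
  rw [hA.rank_eq_card_non_zero_eigs, negIndex_eq hA, posIndex_eq hA, Fintype.card_subtype,
    ← Finset.card_union_of_disjoint]
  · congr 1
    ext i
    simp [lt_or_lt_iff_ne]
  · rw [Finset.disjoint_filter]
    intro i _ h1 h2
    exact lt_asymm h1 h2

theorem det_eq_zero_iff_dimKer_pos {k : ℕ} (A : Matrix (Fin k) (Fin k) ℂ) :
    A.det = 0 ↔ 0 < dimKer A := by
  rw [dimKer, Module.finrank_pos_iff, Submodule.nontrivial_iff_ne_bot, Submodule.ne_bot_iff,
    ← Matrix.exists_mulVec_eq_zero_iff]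
  constructor
  · rintro ⟨v, h0, h⟩
    exact ⟨v, by simpa using h, h0⟩
  · rintro ⟨v, h, h0⟩
    exact ⟨v, h0, by simpa using h⟩

theorem formRe_eq_sum {k : ℕ} {A : Matrix (Fin k) (Fin k) ℂ} (hA : A.IsHermitian)
    (x : Fin k → ℂ) :
    formRe A x = ∑ i, hA.eigenvalues i *
      Complex.normSq ((star (hA.eigenvectorUnitary : Matrix (Fin k) (Fin k) ℂ) *ᵥ x) i) := by
  have h := hA.spectral_theorem
  rw [Unitary.conjStarAlgAut_apply] at h
  set U := (hA.eigenvectorUnitary : Matrix (Fin k) (Fin k) ℂ)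
  have h1 : star x ⬝ᵥ A *ᵥ x = star (star U *ᵥ x) ⬝ᵥ
      (diagonal (RCLike.ofReal ∘ hA.eigenvalues) : Matrix (Fin k) (Fin k) ℂ) *ᵥ (star U *ᵥ x) := by
    conv_lhs => rw [h]
    rw [← mulVec_mulVec, ← mulVec_mulVec, dotProduct_mulVec, star_mulVec]
    simp [star_eq_conjTranspose]
  rw [formRe, h1]
  simp only [dotProduct, mulVec_diagonal, Complex.re_sum, Pi.star_apply, Function.comp_apply]
  refine Finset.sum_congr rfl fun i _ => ?_
  simp [Complex.normSq_apply]
  ring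

/-- Projection to the eigencoordinates of sign `s` is injective on such a space: where they all
vanish, `s` times the form is at most zero. Using a map `f` instead of a subspace avoids a separate
injectivity hypothesis. -/
theorem finrank_le_signIndex {k : ℕ} {A : Matrix (Fin k) (Fin k) ℂ} (hA : A.IsHermitian) (s : ℝ)
    {V : Type*} [AddCommGroup V] [Module ℂ V] [FiniteDimensional ℂ V] (f : V →ₗ[ℂ] (Fin k → ℂ))
    (hf : ∀ v, v ≠ 0 → 0 < s * formRe A (f v)) : Module.finrank ℂ V ≤ signIndex hA s := by
  classical
  let U := (hA.eigenvectorUnitary : Matrix (Fin k) (Fin k) ℂ)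
  let g : V →ₗ[ℂ] ({i // 0 < s * hA.eigenvalues i} → ℂ) :=
    (LinearMap.funLeft ℂ ℂ Subtype.val) ∘ₗ (star U).mulVecLin ∘ₗ f
  have hg : Function.Injective g := by
    rw [injective_iff_map_eq_zero]
    intro v hv
    by_contra hne
    refine (hf v hne).not_ge ?_
    rw [formRe_eq_sum hA, Finset.mul_sum]
    refine Finset.sum_nonpos fun i _ => ?_
    rw [← mul_assoc]
    by_cases hi : 0 < s * hA.eigenvalues i
    · have : (star U *ᵥ f v) i = 0 := congrFun hv ⟨i, hi⟩
      simp [U] at this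
      simp [this]
    · exact mul_nonpos_of_nonpos_of_nonneg (not_lt.1 hi) (Complex.normSq_nonneg _)
  have := LinearMap.finrank_le_finrank_of_injective hg
  rwa [Module.finrank_fintype_fun_eq_card, Fintype.card_subtype] at this

/-- The eigenvectors of sign `s` span the space, so the bound of `finrank_le_signIndex` is attained.
-/
theorem exists_signIndex_map {k : ℕ} {A : Matrix (Fin k) (Fin k) ℂ} (hA : A.IsHermitian) (s : ℝ) :
    ∃ f : (Fin (signIndex hA s) → ℂ) →ₗ[ℂ] (Fin k → ℂ),
      ∀ v, v ≠ 0 → 0 < s * formRe A (f v) := by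
  classical
  let U := (hA.eigenvectorUnitary : Matrix (Fin k) (Fin k) ℂ)
  let e : Fin (signIndex hA s) ≃ {i // 0 < s * hA.eigenvalues i} :=
    Fintype.equivOfCardEq (by rw [Fintype.card_fin, Fintype.card_subtype, signIndex])
  let j : Fin (signIndex hA s) → Fin k := fun a => (e a).1
  have hj : Function.Injective j := Subtype.val_injective.comp e.injective
  refine ⟨U.mulVecLin ∘ₗ Function.ExtendByZero.linearMap ℂ j, fun v hv => ?_⟩
  have hU : star U * U = 1 := Unitary.coe_star_mul_self hA.eigenvectorUnitary
  rw [formRe_eq_sum hA, Finset.mul_sum]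
  have h1 : star U *ᵥ ((U.mulVecLin ∘ₗ Function.ExtendByZero.linearMap ℂ j) v) =
      Function.extend j v 0 := by
    simp only [LinearMap.comp_apply, mulVecLin_apply, mulVec_mulVec, hU, one_mulVec]
    rfl
  obtain ⟨a, ha⟩ := Function.ne_iff.1 hv
  refine Finset.sum_pos' (fun i _ => ?_) ⟨j a, Finset.mem_univ _, ?_⟩
  · rw [h1, ← mul_assoc]
    by_cases hi : ∃ b, j b = i
    · obtain ⟨b, rfl⟩ := hi
      exact mul_nonneg (e b).2.le (Complex.normSq_nonneg _)
    · rw [Function.extend_apply' _ _ _ hi]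
      simp
  · rw [h1, ← mul_assoc, hj.extend_apply]
    exact mul_pos (e a).2 (Complex.normSq_pos.2 ha)

/-! ### Interlacing for a bordered matrix -/

/-- Extension of a vector by a last coordinate `0`. -/
noncomputable def padLast (k : ℕ) : (Fin k → ℂ) →ₗ[ℂ] (Fin (k + 1) → ℂ) :=
  Function.ExtendByZero.linearMap ℂ Fin.castSucc

@[simp] theorem padLast_castSucc {k : ℕ} (x : Fin k → ℂ) (i : Fin k) :
    padLast k x i.castSucc = x i :=
  (Fin.castSucc_injective k).extend_apply _ _ _

@[simp] theorem padLast_last {k : ℕ} (x : Fin k → ℂ) : padLast k x (Fin.last k) = 0 := by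
  refine Function.extend_apply' _ _ _ ?_
  rintro ⟨a, ha⟩
  exact (Fin.castSucc_lt_last a).ne ha

theorem formRe_of_last_eq_zero {k : ℕ} (B : Matrix (Fin (k + 1)) (Fin (k + 1)) ℂ)
    (x : Fin (k + 1) → ℂ) (hx : x (Fin.last k) = 0) :
    formRe B x = formRe (B.submatrix Fin.castSucc Fin.castSucc) (x ∘ Fin.castSucc) := by
  simp [formRe, dotProduct, mulVec, Fin.sum_univ_castSucc, hx]

theorem signIndex_submatrix_le {k : ℕ} {B : Matrix (Fin (k + 1)) (Fin (k + 1)) ℂ}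
    (hB : B.IsHermitian) (hA : (B.submatrix Fin.castSucc Fin.castSucc).IsHermitian) (s : ℝ) :
    signIndex hA s ≤ signIndex hB s := by
  obtain ⟨f, hf⟩ := exists_signIndex_map hA s
  have := finrank_le_signIndex hB s (padLast k ∘ₗ f) fun v hv => by
    rw [formRe_of_last_eq_zero _ _ (by simp)]
    convert hf v hv using 3
    ext i
    simp
  simpa using this

theorem signIndex_le_submatrix_add_one {k : ℕ} {B : Matrix (Fin (k + 1)) (Fin (k + 1)) ℂ}
    (hB : B.IsHermitian) (hA : (B.submatrix Fin.castSucc Fin.castSucc).IsHermitian) (s : ℝ) :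
    signIndex hB s ≤ signIndex hA s + 1 := by
  obtain ⟨f, hf⟩ := exists_signIndex_map hB s
  -- Vanishing of the last coordinate costs at most one dimension, and there the form is that of the
  -- submatrix.
  let l : (Fin (signIndex hB s) → ℂ) →ₗ[ℂ] ℂ := LinearMap.proj (Fin.last k) ∘ₗ f
  have h1 := finrank_le_signIndex hA s
    (LinearMap.funLeft ℂ ℂ Fin.castSucc ∘ₗ f ∘ₗ (LinearMap.ker l).subtype) fun v hv => by
      have h2 := hf v.1 (by simpa using hv)
      rw [formRe_of_last_eq_zero _ _ (show f v.1 (Fin.last k) = 0 from v.2)] at h2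
      exact h2
  have h3 := LinearMap.finrank_range_add_finrank_ker l
  have h4 : Module.finrank ℂ (LinearMap.range l) ≤ 1 := by
    simpa using Submodule.finrank_le (LinearMap.range l)
  simp only [Module.finrank_fintype_fun_eq_card, Fintype.card_fin] at h3
  omega

/-- A vector orthogonal to the first `k` coordinate vectors raises the index of its sign. -/
theorem signIndex_submatrix_add_one_le {k : ℕ} {B : Matrix (Fin (k + 1)) (Fin (k + 1)) ℂ}
    (hB : B.IsHermitian) (hA : (B.submatrix Fin.castSucc Fin.castSucc).IsHermitian) (s : ℝ)
    (u : Fin (k + 1) → ℂ) (hu : u (Fin.last k) = 1) (g : ℝ)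
    (hBu : B *ᵥ u = Pi.single (Fin.last k) (g : ℂ)) (hg : 0 < s * g) :
    signIndex hA s + 1 ≤ signIndex hB s := by
  obtain ⟨f, hf⟩ := exists_signIndex_map hA s
  let F : ((Fin (signIndex hA s) → ℂ) × ℂ) →ₗ[ℂ] (Fin (k + 1) → ℂ) :=
    (padLast k ∘ₗ f).coprod (LinearMap.toSpanSingleton ℂ _ u)
  -- By `hBu`, `u` is `B`-orthogonal to all vectors with last coordinate zero, so the form splits.
  have key : ∀ y a, formRe B (padLast k y + a • u) =
      formRe (B.submatrix Fin.castSucc Fin.castSucc) y + Complex.normSq a * g := by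
    intro y a
    have e1 : formRe (B.submatrix Fin.castSucc Fin.castSucc) y = formRe B (padLast k y) := by
      rw [formRe_of_last_eq_zero B (padLast k y) (by simp)]
      congr 1
      ext i
      simp
    have e2 : star (padLast k y) ⬝ᵥ B *ᵥ u = 0 := by
      simp [hBu]
    have e3 : star u ⬝ᵥ B *ᵥ (padLast k y) = 0 := by
      rw [dotProduct_mulVec, ← hB.eq, ← star_mulVec, hBu, ← Pi.single_star]
      simp
    have e4 : star u ⬝ᵥ B *ᵥ u = g := by simp [hBu, hu]
    rw [e1, formRe, formRe]
    simp only [star_add, star_smul, mulVec_add, mulVec_smul, add_dotProduct, dotProduct_add,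
      smul_dotProduct, dotProduct_smul, e2, e3, e4]
    simp [Complex.normSq_apply]
    ring
  have h1 := finrank_le_signIndex hB s F fun v hv => by
    obtain ⟨y, a⟩ := v
    have hF : F (y, a) = padLast k (f y) + a • u := by simp [F]
    rw [hF, key]
    have h2 : 0 ≤ Complex.normSq a := Complex.normSq_nonneg a
    by_cases hy : y = 0
    · subst hy
      have ha : 0 < Complex.normSq a := Complex.normSq_pos.2 (by rintro rfl; exact hv rfl)
      have := mul_pos ha hg
      simp [formRe]
      linarith
    · have := hf y hy
      have := mul_nonneg h2 hg.le
      linarith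
  simpa using h1

/-! ### Toeplitz matrices as convolutions -/

/-- The Toeplitz matrix of order `k` of the sequence `d`. -/
noncomputable def toep (d : ℕ → ℂ) (k : ℕ) : Matrix (Fin k) (Fin k) ℂ :=
  toeplitz fun i : Fin k => d i

/-- The two-sided Hermitian extension of the sequence `d`. -/
noncomputable def herm (d : ℕ → ℂ) (j : ℤ) : ℂ :=
  if 0 ≤ j then d j.toNat else star (d (-j).toNat)

theorem toep_isHermitian {d : ℕ → ℂ} (h0 : star (d 0) = d 0) (k : ℕ) : (toep d k).IsHermitian :=
  toeplitz_isHermitian _ fun _ => h0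

theorem toep_submatrix (d : ℕ → ℂ) (k : ℕ) :
    (toep d (k + 1)).submatrix Fin.castSucc Fin.castSucc = toep d k := by
  ext i j
  simp [toep, toeplitz]

theorem toep_congr {d d' : ℕ → ℂ} {k : ℕ} (h : ∀ i < k, d' i = d i) : toep d' k = toep d k := by
  unfold toep
  congr 1
  ext i
  exact h i i.2

theorem toep_apply (d : ℕ → ℂ) {k : ℕ} (i j : Fin k) :
    toep d k i j = herm d ((i : ℤ) - (j : ℤ)) := by
  by_cases h : j ≤ i
  · have h1 : (0 : ℤ) ≤ (i : ℤ) - (j : ℤ) := by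
      have : (j : ℕ) ≤ i := h
      omega
    simp only [toep, toeplitz, Matrix.of_apply, h, if_true, herm, h1]
    congr 1
    omega
  · have h1 : ¬ (0 : ℤ) ≤ (i : ℤ) - (j : ℤ) := by
      have : ¬ (j : ℕ) ≤ i := h
      omega
    simp only [toep, toeplitz, Matrix.of_apply, h, if_false, herm, h1]
    congr 2
    omega

theorem herm_neg {d : ℕ → ℂ} (h0 : star (d 0) = d 0) (j : ℤ) : herm d (-j) = star (herm d j) := by
  rcases lt_trichotomy j 0 with h | rfl | h
  · simp [herm, h.le, h.not_ge]
  · simpa [herm] using h0.symm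
  · simp [herm, h.le, h.not_ge]

/-- The convolution of the two-sided sequence of `d` with `x`. -/
noncomputable def conv (d : ℕ → ℂ) (x : ℤ → ℂ) (j : ℤ) : ℂ :=
  ∑ᶠ i : ℤ, herm d (j - i) * x i

/-- Extension of a finite vector by zero to all integer indices. -/
noncomputable def padInt (k : ℕ) : (Fin k → ℂ) →ₗ[ℂ] (ℤ → ℂ) :=
  Function.ExtendByZero.linearMap ℂ fun i : Fin k => ((i : ℕ) : ℤ)

theorem natCast_fin_injective (k : ℕ) : Function.Injective fun i : Fin k => ((i : ℕ) : ℤ) :=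
  Nat.cast_injective.comp Fin.val_injective

@[simp] theorem padInt_natCast {k : ℕ} (v : Fin k → ℂ) (i : Fin k) :
    padInt k v ((i : ℕ) : ℤ) = v i :=
  (natCast_fin_injective k).extend_apply _ _ _

theorem padInt_injective (k : ℕ) : Function.Injective (padInt k) := by
  intro v w h
  ext i
  simpa using congrFun h ((i : ℕ) : ℤ)

theorem padInt_of_not {k : ℕ} (v : Fin k → ℂ) {i : ℤ} (hi : ¬ (0 ≤ i ∧ i < k)) :
    padInt k v i = 0 := by
  refine Function.extend_apply' _ _ _ ?_
  rintro ⟨a, rfl⟩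
  exact hi ⟨by positivity, by exact_mod_cast a.2⟩

theorem padInt_restrict {k : ℕ} {x : ℤ → ℂ} (hx : ∀ i : ℤ, ¬ (0 ≤ i ∧ i < k) → x i = 0) :
    padInt k (fun i => x ((i : ℕ) : ℤ)) = x := by
  ext i
  by_cases hi : 0 ≤ i ∧ i < k
  · obtain ⟨m, rfl⟩ := Int.eq_ofNat_of_zero_le hi.1
    exact padInt_natCast (fun i : Fin k => x ((i : ℕ) : ℤ)) ⟨m, by omega⟩
  · rw [padInt_of_not _ hi, hx i hi]

theorem conv_eq_sum (d : ℕ → ℂ) {k : ℕ} {x : ℤ → ℂ} (hx : ∀ i : ℤ, ¬ (0 ≤ i ∧ i < k) → x i = 0)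
    (j : ℤ) : conv d x j = ∑ i : Fin k, herm d (j - ((i : ℕ) : ℤ)) * x ((i : ℕ) : ℤ) := by
  rw [conv, finsum_eq_sum_of_support_subset
    (s := Finset.univ.map ⟨fun i : Fin k => ((i : ℕ) : ℤ), natCast_fin_injective k⟩)]
  · simp
  · intro i hi
    have : 0 ≤ i ∧ i < k := by
      by_contra h
      exact hi (by simp [hx i h])
    obtain ⟨m, rfl⟩ := Int.eq_ofNat_of_zero_le this.1
    simp only [Finset.coe_map, Function.Embedding.coeFn_mk, Finset.coe_univ, Set.image_univ,
      Set.mem_range]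
    exact ⟨⟨m, by omega⟩, rfl⟩

theorem toep_mulVec (d : ℕ → ℂ) {k : ℕ} {x : ℤ → ℂ}
    (hx : ∀ i : ℤ, ¬ (0 ≤ i ∧ i < k) → x i = 0) (j : Fin k) :
    (toep d k *ᵥ fun i => x ((i : ℕ) : ℤ)) j = conv d x ((j : ℕ) : ℤ) := by
  simp [conv_eq_sum d hx, mulVec, dotProduct, toep_apply]

theorem conv_shift (d : ℕ → ℂ) (x : ℤ → ℂ) (a j : ℤ) :
    conv d (fun i => x (i + a)) j = conv d x (j + a) := by
  rw [conv, conv, ← finsum_comp_equiv (Equiv.addRight a) (f := fun i => herm d (j + a - i) * x i)]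
  simp

/-- This is the symmetry `herm_neg` of the kernel of the convolution. It transfers statements about
the last coordinate or equation to the first. -/
theorem conv_reverse {d : ℕ → ℂ} (h0 : star (d 0) = d 0) (x : ℤ → ℂ) (m j : ℤ) :
    conv d (fun i => star (x (m - i))) j = star (conv d x (m - j)) := by
  have h1 := AddEquiv.map_finsum (starAddEquiv : ℂ ≃+ ℂ) (fun i => herm d (m - j - i) * x i)
  rw [conv, conv, ← starAddEquiv_apply, h1, ← finsum_comp_equiv (Equiv.subLeft m)]
  refine finsum_congr fun i => ?_
  simp only [Equiv.subLeft_apply, starAddEquiv_apply, star_mul', ← herm_neg h0]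
  congr 2
  · ring
  · simp

/-! ### Kernels and shifts -/

/-- The kernel of the Toeplitz matrix of order `k`, as a space of sequences supported in
`[0, k)`. -/
noncomputable def kerToep (d : ℕ → ℂ) (k : ℕ) : Submodule ℂ (ℤ → ℂ) :=
  (LinearMap.ker (toep d k).mulVecLin).map (padInt k)

theorem mem_kerToep {d : ℕ → ℂ} {k : ℕ} {x : ℤ → ℂ} :
    x ∈ kerToep d k ↔
      (∀ i : ℤ, ¬ (0 ≤ i ∧ i < k) → x i = 0) ∧ ∀ j : ℤ, 0 ≤ j → j < k → conv d x j = 0 := by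
  constructor
  · rintro ⟨v, hv, rfl⟩
    refine ⟨fun i => padInt_of_not v, fun j h1 h2 => ?_⟩
    obtain ⟨m, rfl⟩ := Int.eq_ofNat_of_zero_le h1
    have := toep_mulVec d (fun i => padInt_of_not v (i := i)) ⟨m, by omega⟩
    simp only [padInt_natCast] at this
    rw [← this]
    exact congrFun hv _
  · rintro ⟨h1, h2⟩
    refine ⟨fun i => x ((i : ℕ) : ℤ), ?_, padInt_restrict h1⟩
    ext j
    exact (toep_mulVec d h1 j).trans (h2 _ (by positivity) (by exact_mod_cast j.2))

instance (d : ℕ → ℂ) (k : ℕ) : FiniteDimensional ℂ (kerToep d k) := by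
  unfold kerToep
  infer_instance

theorem finrank_kerToep (d : ℕ → ℂ) (k : ℕ) :
    Module.finrank ℂ (kerToep d k) = dimKer (toep d k) :=
  (Submodule.equivMapOfInjective _ (padInt_injective k) _).finrank_eq.symm

theorem reverse_mem_kerToep {d : ℕ → ℂ} (h0 : star (d 0) = d 0) {k : ℕ} {x : ℤ → ℂ}
    (hx : x ∈ kerToep d k) : (fun i => star (x (k - 1 - i))) ∈ kerToep d k := by
  rw [mem_kerToep] at hx ⊢
  refine ⟨fun i hi => ?_, fun j h1 h2 => ?_⟩
  · rw [hx.1 _ (by omega), star_zero]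
  · rw [conv_reverse h0, hx.2 _ (by omega) (by omega), star_zero]

/-- No nonzero space of sequences supported in `[0, k)` is invariant under a nontrivial shift. -/
theorem eq_bot_of_shift_invariant {W : Submodule ℂ (ℤ → ℂ)} {k : ℕ}
    (hW : ∀ x ∈ W, ∀ i : ℤ, ¬ (0 ≤ i ∧ i < k) → x i = 0) {a : ℤ} (ha : a ≠ 0)
    (h : ∀ x ∈ W, (fun i => x (i + a)) ∈ W) : W = ⊥ := by
  rw [Submodule.eq_bot_iff]
  intro x hx
  have hm : ∀ m : ℕ, (fun i => x (i + m * a)) ∈ W := by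
    intro m
    induction m with
    | zero => simpa using hx
    | succ m ih =>
      convert h _ ih using 2 with i
      push_cast
      ring_nf
  ext i
  -- After `k + |i|` shifts the value `x i` sits outside `[0, k)`, where it must vanish.
  have h1 := hW _ (hm (k + i.natAbs)) (i - ((k + i.natAbs : ℕ) : ℤ) * a) (by
    have h2 := abs_nonneg i
    push_cast
    rcases lt_or_gt_of_ne ha with h3 | h3
    · have : (k + |i|) * 1 ≤ (k + |i|) * (-a) := by
        apply mul_le_mul_of_nonneg_left <;> omega
      have := neg_abs_le i
      intro h4
      nlinarith
    · have : (k + |i|) * 1 ≤ (k + |i|) * a := by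
        apply mul_le_mul_of_nonneg_left <;> omega
      have := le_abs_self i
      intro h4
      by_cases hk : (k : ℤ) = 0
      · omega
      · have : 0 < (k : ℤ) := by omega
        nlinarith)
  simpa using h1

theorem kerToep_support {d : ℕ → ℂ} {k : ℕ} {x : ℤ → ℂ} (hx : x ∈ kerToep d k) :
    ∀ i : ℤ, ¬ (0 ≤ i ∧ i < k) → x i = 0 :=
  (mem_kerToep.1 hx).1

/-- The matrix of order `k + 1` maps `x` to a nonzero multiple of the last coordinate vector, and
the range of a Hermitian matrix is orthogonal to its kernel. -/
theorem last_eq_zero_of_conv_ne_zero {d : ℕ → ℂ} (h0 : star (d 0) = d 0) {k : ℕ} {x y : ℤ → ℂ}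
    (hx : x ∈ kerToep d k) (hxk : conv d x k ≠ 0) (hy : y ∈ kerToep d (k + 1)) : y k = 0 := by
  have hx1 : ∀ i : ℤ, ¬ (0 ≤ i ∧ i < (k + 1 : ℕ)) → x i = 0 := fun i hi =>
    kerToep_support hx i (by push_cast at hi; omega)
  have hy' := mem_kerToep.1 hy
  set x' : Fin (k + 1) → ℂ := fun i => x ((i : ℕ) : ℤ)
  set y' : Fin (k + 1) → ℂ := fun i => y ((i : ℕ) : ℤ)
  have e1 : toep d (k + 1) *ᵥ y' = 0 := by
    ext j
    exact (toep_mulVec d hy'.1 j).trans (hy'.2 _ (by positivity) (by exact_mod_cast j.2))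
  have e2 : toep d (k + 1) *ᵥ x' = Pi.single (Fin.last k) (conv d x k) := by
    ext j
    rw [toep_mulVec d hx1 j]
    refine Fin.lastCases ?_ (fun i => ?_) j
    · simp
    · rw [(mem_kerToep.1 hx).2 _ (by positivity) (by simp)]
      simp
  have e3 : star y' ⬝ᵥ toep d (k + 1) *ᵥ x' = 0 := by
    rw [dotProduct_mulVec, ← (toep_isHermitian h0 (k + 1)).eq, ← star_mulVec, e1]
    simp
  rw [e2] at e3
  simpa [y', hxk] using e3

theorem kerToep_le_or_lt {d : ℕ → ℂ} (h0 : star (d 0) = d 0) (k : ℕ) :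
    (∀ x ∈ kerToep d k, conv d x k = 0) ∧ kerToep d k ≤ kerToep d (k + 1) ∨
      (∃ x ∈ kerToep d k, conv d x k ≠ 0) ∧ kerToep d (k + 1) < kerToep d k := by
  by_cases h : ∃ x ∈ kerToep d k, conv d x k ≠ 0
  · refine Or.inr ⟨h, ?_⟩
    obtain ⟨x, hx, hxk⟩ := h
    refine lt_of_le_of_ne (fun y hy => ?_) fun he => ?_
    · have hyk := last_eq_zero_of_conv_ne_zero h0 hx hxk hy
      rw [mem_kerToep] at hy ⊢
      refine ⟨fun i hi => ?_, fun j h1 h2 => hy.2 j h1 (by push_cast; omega)⟩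
      by_cases hik : i = k
      · rw [hik, hyk]
      · exact hy.1 i (by push_cast; omega)
    · rw [← he, mem_kerToep] at hx
      exact hxk (hx.2 k (by positivity) (by push_cast; omega))
  · push Not at h
    refine Or.inl ⟨h, fun x hx => ?_⟩
    have hx' := mem_kerToep.1 hx
    refine mem_kerToep.2 ⟨fun i hi => hx'.1 i (by push_cast at hi; omega), fun j h1 h2 => ?_⟩
    by_cases hjk : j = k
    · rw [hjk, h x hx]
    · exact hx'.2 j h1 (by push_cast at h2; omega)

theorem dimKer_lt_of_exists {d : ℕ → ℂ} (h0 : star (d 0) = d 0) {k : ℕ}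
    (h : ∃ x ∈ kerToep d k, conv d x k ≠ 0) : dimKer (toep d (k + 1)) < dimKer (toep d k) := by
  rcases kerToep_le_or_lt h0 k with h1 | h1
  · obtain ⟨x, hx, hxk⟩ := h
    exact absurd (h1.1 x hx) hxk
  · rw [← finrank_kerToep, ← finrank_kerToep]
    exact Submodule.finrank_lt_finrank_of_lt h1.2

/-- The hypothesis gives inclusion of the kernels. Were they equal, the kernel would be invariant
under the right shift: the one new equation, at index `-1`, is the hypothesis applied to the
reversed vector. -/
theorem lt_dimKer_of_forall {d : ℕ → ℂ} (h0 : star (d 0) = d 0) {k : ℕ}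
    (hk : 0 < dimKer (toep d k)) (h : ∀ x ∈ kerToep d k, conv d x k = 0) :
    dimKer (toep d k) < dimKer (toep d (k + 1)) := by
  have hle : kerToep d k ≤ kerToep d (k + 1) := by
    rcases kerToep_le_or_lt h0 k with h1 | ⟨⟨x, hx, hxk⟩, -⟩
    · exact h1.2
    · exact absurd (h x hx) hxk
  by_contra hlt
  rw [← finrank_kerToep, ← finrank_kerToep, not_lt] at hlt
  have he := Submodule.eq_of_le_of_finrank_le hle hlt
  have hbot : kerToep d k = ⊥ := by
    refine eq_bot_of_shift_invariant (fun x hx => kerToep_support hx) (a := -1) (by norm_num)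
      fun x hx => ?_
    have hx' := mem_kerToep.1 hx
    rw [he, mem_kerToep]
    refine ⟨fun i hi => hx'.1 _ (by push_cast at hi; omega), fun j h1 h2 => ?_⟩
    rw [conv_shift]
    by_cases hj : j = 0
    · have h3 := h _ (reverse_mem_kerToep h0 hx)
      rw [conv_reverse h0, star_eq_zero] at h3
      rw [← h3, hj]
      congr 1
      ring
    · exact hx'.2 _ (by omega) (by push_cast at h2; omega)
  rw [← finrank_kerToep, hbot, finrank_bot] at hk
  exact lt_irrefl _ hk

/-- After a drop, kernel vectors of order `k + 1` vanish at the last coordinate and, by reversal, at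
the first. If there were no further drop, the left shift would preserve this kernel. -/
theorem dimKer_decreasing_step {d : ℕ → ℂ} (h0 : star (d 0) = d 0) {k : ℕ}
    (h1 : dimKer (toep d (k + 1)) < dimKer (toep d k)) (h2 : 0 < dimKer (toep d (k + 1))) :
    dimKer (toep d (k + 2)) < dimKer (toep d (k + 1)) := by
  refine dimKer_lt_of_exists h0 ?_
  by_contra! hcon
  rcases kerToep_le_or_lt h0 k with h3 | ⟨⟨x, hx, hxk⟩, -⟩
  · rw [← finrank_kerToep, ← finrank_kerToep] at h1
    exact h1.not_ge (Submodule.finrank_mono h3.2)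
  have hlast : ∀ y ∈ kerToep d (k + 1), y k = 0 := fun y hy =>
    last_eq_zero_of_conv_ne_zero h0 hx hxk hy
  have hfirst : ∀ y ∈ kerToep d (k + 1), y 0 = 0 := fun y hy => by
    simpa using hlast _ (reverse_mem_kerToep h0 hy)
  have hbot : kerToep d (k + 1) = ⊥ := by
    refine eq_bot_of_shift_invariant (fun x hx => kerToep_support hx) (a := 1) (by norm_num)
      fun y hy => ?_
    have hy' := mem_kerToep.1 hy
    refine mem_kerToep.2 ⟨fun i hi => ?_, fun j h4 h5 => ?_⟩
    · by_cases hi0 : i = -1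
      · rw [hi0]
        exact hfirst y hy
      · exact hy'.1 _ (by push_cast at hi ⊢; omega)
    · rw [conv_shift]
      by_cases hj : j = k
      · rw [hj]
        exact_mod_cast hcon y hy
      · exact hy'.2 _ (by omega) (by push_cast at h5 ⊢; omega)
  rw [← finrank_kerToep, hbot, finrank_bot] at h2
  exact lt_irrefl _ h2

/-! ### Inertia and nullity along the sequence of orders -/

theorem negIndex_add_posIndex_add_dimKer {d : ℕ → ℂ} (h0 : star (d 0) = d 0) (k : ℕ) :
    negIndex (toep d k) + posIndex (toep d k) + dimKer (toep d k) = k := by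
  rw [negIndex_add_posIndex_eq_rank (toep_isHermitian h0 k), rank_add_dimKer]

theorem signIndex_toep_succ {d : ℕ → ℂ} (h0 : star (d 0) = d 0) (k : ℕ) (s : ℝ) :
    signIndex (toep_isHermitian h0 k) s ≤ signIndex (toep_isHermitian h0 (k + 1)) s ∧
      signIndex (toep_isHermitian h0 (k + 1)) s ≤ signIndex (toep_isHermitian h0 k) s + 1 := by
  have hA : ((toep d (k + 1)).submatrix Fin.castSucc Fin.castSucc).IsHermitian := by
    rw [toep_submatrix]
    exact toep_isHermitian h0 k
  have e : signIndex hA s = signIndex (toep_isHermitian h0 k) s := by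
    congr 1
  rw [← e]
  exact ⟨signIndex_submatrix_le _ hA s, signIndex_le_submatrix_add_one _ hA s⟩

theorem negIndex_toep_succ {d : ℕ → ℂ} (h0 : star (d 0) = d 0) (k : ℕ) :
    negIndex (toep d k) ≤ negIndex (toep d (k + 1)) ∧
      negIndex (toep d (k + 1)) ≤ negIndex (toep d k) + 1 := by
  simpa only [signIndex_neg_one] using signIndex_toep_succ h0 k (-1)

theorem posIndex_toep_succ {d : ℕ → ℂ} (h0 : star (d 0) = d 0) (k : ℕ) :
    posIndex (toep d k) ≤ posIndex (toep d (k + 1)) ∧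
      posIndex (toep d (k + 1)) ≤ posIndex (toep d k) + 1 := by
  simpa only [signIndex_one] using signIndex_toep_succ h0 k 1

theorem negIndex_toep_mono {d : ℕ → ℂ} (h0 : star (d 0) = d 0) :
    Monotone fun k => negIndex (toep d k) :=
  monotone_nat_of_le_succ fun k => (negIndex_toep_succ h0 k).1

theorem posIndex_toep_mono {d : ℕ → ℂ} (h0 : star (d 0) = d 0) :
    Monotone fun k => posIndex (toep d k) :=
  monotone_nat_of_le_succ fun k => (posIndex_toep_succ h0 k).1

/-- The inertia after a step that lowers the dimension of the kernel. -/
theorem inertia_of_dimKer_lt {d : ℕ → ℂ} (h0 : star (d 0) = d 0) {k : ℕ}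
    (h : dimKer (toep d (k + 1)) < dimKer (toep d k)) :
    dimKer (toep d (k + 1)) + 1 = dimKer (toep d k) ∧
      negIndex (toep d (k + 1)) = negIndex (toep d k) + 1 ∧
      posIndex (toep d (k + 1)) = posIndex (toep d k) + 1 := by
  have h1 := negIndex_add_posIndex_add_dimKer h0 k
  have h2 := negIndex_add_posIndex_add_dimKer h0 (k + 1)
  have h3 := negIndex_toep_succ h0 k
  have h4 := posIndex_toep_succ h0 k
  omega

/-- The inertia after a step that raises the dimension of the kernel. -/
theorem inertia_of_lt_dimKer {d : ℕ → ℂ} (h0 : star (d 0) = d 0) {k : ℕ}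
    (h : dimKer (toep d k) < dimKer (toep d (k + 1))) :
    dimKer (toep d (k + 1)) = dimKer (toep d k) + 1 ∧
      negIndex (toep d (k + 1)) = negIndex (toep d k) ∧
      posIndex (toep d (k + 1)) = posIndex (toep d k) := by
  have h1 := negIndex_add_posIndex_add_dimKer h0 k
  have h2 := negIndex_add_posIndex_add_dimKer h0 (k + 1)
  have h3 := negIndex_toep_succ h0 k
  have h4 := posIndex_toep_succ h0 k
  omega

theorem dimKer_lt_or_lt {d : ℕ → ℂ} (h0 : star (d 0) = d 0) {k : ℕ}
    (hk : 0 < dimKer (toep d k)) :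
    dimKer (toep d (k + 1)) < dimKer (toep d k) ∨ dimKer (toep d k) < dimKer (toep d (k + 1)) := by
  by_cases h : ∃ x ∈ kerToep d k, conv d x k ≠ 0
  · exact Or.inl (dimKer_lt_of_exists h0 h)
  · push Not at h
    exact Or.inr (lt_dimKer_of_forall h0 hk h)

/-- Once the kernel has started to shrink, it shrinks until it vanishes. -/
theorem inertia_of_shrinking {d : ℕ → ℂ} (h0 : star (d 0) = d 0) {k : ℕ}
    (h : dimKer (toep d (k + 1)) < dimKer (toep d k)) (j : ℕ) (hj : j ≤ dimKer (toep d k)) :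
    dimKer (toep d (k + j)) + j = dimKer (toep d k) ∧
      negIndex (toep d (k + j)) = negIndex (toep d k) + j ∧
      posIndex (toep d (k + j)) = posIndex (toep d k) + j := by
  have key : ∀ j, j < dimKer (toep d k) →
      dimKer (toep d (k + j + 1)) < dimKer (toep d (k + j)) ∧
      dimKer (toep d (k + j)) + j = dimKer (toep d k) ∧
      negIndex (toep d (k + j)) = negIndex (toep d k) + j ∧
      posIndex (toep d (k + j)) = posIndex (toep d k) + j := by
    intro j
    induction j with
    | zero => exact fun _ => ⟨h, rfl, rfl, rfl⟩
    | succ j ih =>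
      intro hj
      obtain ⟨h1, h2, h3, h4⟩ := ih (by omega)
      obtain ⟨h5, h6, h7⟩ := inertia_of_dimKer_lt h0 h1
      rw [show k + (j + 1) = k + j + 1 from rfl]
      exact ⟨dimKer_decreasing_step h0 h1 (by omega), by omega, by omega, by omega⟩
  cases j with
  | zero => exact ⟨rfl, rfl, rfl⟩
  | succ j =>
    obtain ⟨h1, h2, h3, h4⟩ := key j (by omega)
    obtain ⟨h5, h6, h7⟩ := inertia_of_dimKer_lt h0 h1
    rw [show k + (j + 1) = k + j + 1 from rfl]
    omega

/-- Steps backwards from a growing kernel are growing, as long as the kernel does not vanish. -/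
theorem dimKer_sub_of_growing {d : ℕ → ℂ} (h0 : star (d 0) = d 0) {n : ℕ}
    (h : dimKer (toep d n) < dimKer (toep d (n + 1))) (j : ℕ) (hj : j ≤ dimKer (toep d n)) :
    dimKer (toep d (n - j)) + j = dimKer (toep d n) := by
  have key : ∀ j, j ≤ dimKer (toep d n) → dimKer (toep d (n - j)) + j = dimKer (toep d n) ∧
      dimKer (toep d (n - j)) < dimKer (toep d (n - j + 1)) := by
    intro j
    induction j with
    | zero => exact fun _ => ⟨rfl, h⟩
    | succ j ih =>
      intro hj
      obtain ⟨h1, h2⟩ := ih (by omega)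
      have h3 := negIndex_add_posIndex_add_dimKer h0 n
      obtain ⟨m, hm⟩ : ∃ m, n - j = m + 1 := ⟨n - j - 1, by omega⟩
      have hm' : n - (j + 1) = m := by omega
      rw [hm] at h1 h2
      rw [hm']
      have h5 : dimKer (toep d m) < dimKer (toep d (m + 1)) := by
        rcases Nat.eq_zero_or_pos (dimKer (toep d m)) with h4 | h4
        · omega
        -- A drop here would be followed by another drop, contrary to `h2`.
        · refine (dimKer_lt_or_lt h0 h4).resolve_left fun h6 => ?_
          have := dimKer_decreasing_step h0 h6 (by omega)
          exact absurd h2 this.not_gt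
      have := inertia_of_lt_dimKer h0 h5
      exact ⟨by omega, h5⟩
  exact (key j hj).1

/-- In the singular case the kernel shrinks in the next step. -/
theorem dimKer_lt_of_singular {d : ℕ → ℂ} (h0 : star (d 0) = d 0) {n : ℕ}
    (hn : 0 < dimKer (toep d n)) (hs : dimKer (toep d (n - dimKer (toep d n))) ≠ 0) :
    dimKer (toep d (n + 1)) < dimKer (toep d n) := by
  refine (dimKer_lt_or_lt h0 hn).resolve_right fun h => hs ?_
  have := dimKer_sub_of_growing h0 h _ le_rfl
  omega

/-- In the regular case the kernel contains a vector with nonzero first coordinate. -/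
theorem exists_mem_kerToep_of_regular {d : ℕ → ℂ} (h0 : star (d 0) = d 0) {ρ n : ℕ}
    (hρ : dimKer (toep d ρ) = 0) (hn : 0 < dimKer (toep d n)) (hρn : ρ + dimKer (toep d n) = n) :
    ∃ p ∈ kerToep d n, p 0 ≠ 0 := by
  have h1 := negIndex_add_posIndex_add_dimKer h0 n
  have h2 := negIndex_add_posIndex_add_dimKer h0 ρ
  -- Orders `ρ` and `n` have the same rank, so by monotonicity both indices are constant between
  -- them.
  have key : ∀ j, ρ + j ≤ n → dimKer (toep d (ρ + j)) = j := by
    intro j hj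
    have h3 := negIndex_add_posIndex_add_dimKer h0 (ρ + j)
    have h4 := negIndex_toep_mono h0 hj
    have h5 := posIndex_toep_mono h0 hj
    have h6 := negIndex_toep_mono h0 (Nat.le_add_right ρ j)
    have h7 := posIndex_toep_mono h0 (Nat.le_add_right ρ j)
    dsimp only at *
    omega
  have hle : ∀ j, ρ + 1 + j ≤ n → kerToep d (ρ + 1) ≤ kerToep d (ρ + 1 + j) := by
    intro j
    induction j with
    | zero => exact fun _ => le_rfl
    | succ j ih =>
      intro hj
      refine (ih (by omega)).trans ?_
      rcases kerToep_le_or_lt h0 (ρ + 1 + j) with h3 | ⟨h3, -⟩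
      · exact h3.2
      · have h4 := dimKer_lt_of_exists h0 h3
        have h5 := key (1 + j) (by omega)
        have h6 := key (1 + j + 1) (by omega)
        rw [show ρ + (1 + j) = ρ + 1 + j by omega] at h5
        rw [show ρ + (1 + j + 1) = ρ + 1 + j + 1 by omega] at h6
        omega
  have hdim : 0 < Module.finrank ℂ (kerToep d (ρ + 1)) := by
    rw [finrank_kerToep, key 1 (by omega)]
    exact one_pos
  have : Nontrivial (kerToep d (ρ + 1)) := Module.finrank_pos_iff.1 hdim
  obtain ⟨⟨q, hq⟩, hq0⟩ := exists_ne (0 : kerToep d (ρ + 1))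
  -- Otherwise `q` would lie in the trivial kernel of order `ρ`. Reversal turns this into a nonzero
  -- first coordinate.
  have hlast : q ρ ≠ 0 := by
    intro hqρ
    have hq' := mem_kerToep.1 hq
    have hmem : q ∈ kerToep d ρ := by
      refine mem_kerToep.2 ⟨fun i hi => ?_, fun j h3 h4 => hq'.2 j h3 (by push_cast; omega)⟩
      by_cases hi' : i = ρ
      · rw [hi', hqρ]
      · exact hq'.1 i (by push_cast; omega)
    have hbot : kerToep d ρ = ⊥ := by
      rw [← Submodule.finrank_eq_zero (R := ℂ), finrank_kerToep, hρ]
    rw [hbot, Submodule.mem_bot] at hmem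
    exact hq0 (by simpa using hmem)
  refine ⟨fun i => star (q ((ρ + 1 : ℕ) - 1 - i)), ?_, ?_⟩
  · have := hle (n - (ρ + 1)) (by omega) (reverse_mem_kerToep h0 hq)
    rwa [show ρ + 1 + (n - (ρ + 1)) = n by omega] at this
  · simpa using hlast

/-- One vector decides for the whole kernel: the reversal of `p` in order `k + 1` has last
coordinate `star (p 0) ≠ 0`, which a shrinking kernel forbids. -/
theorem lt_dimKer_of_conv_eq_zero {d : ℕ → ℂ} (h0 : star (d 0) = d 0) {k : ℕ} {p : ℤ → ℂ}
    (hp : p ∈ kerToep d k) (hp0 : p 0 ≠ 0) (h : conv d p k = 0) :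
    dimKer (toep d k) < dimKer (toep d (k + 1)) ∧ p ∈ kerToep d (k + 1) := by
  have hp' := mem_kerToep.1 hp
  have hmem : p ∈ kerToep d (k + 1) := by
    refine mem_kerToep.2 ⟨fun i hi => hp'.1 i (by push_cast at hi; omega), fun j h1 h2 => ?_⟩
    by_cases hjk : j = k
    · rw [hjk, h]
    · exact hp'.2 j h1 (by push_cast at h2; omega)
  refine ⟨lt_dimKer_of_forall h0 ?_ ?_, hmem⟩
  · rw [← finrank_kerToep, Module.finrank_pos_iff, Submodule.nontrivial_iff_ne_bot,
      Submodule.ne_bot_iff]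
    exact ⟨p, hp, fun h => hp0 (by rw [h]; rfl)⟩
  · by_contra! hcon
    obtain ⟨x, hx, hxk⟩ := hcon
    have := last_eq_zero_of_conv_ne_zero h0 hx hxk (reverse_mem_kerToep h0 hmem)
    simp [hp0] at this

/-! ### One-step extensions of a nondegenerate matrix -/

theorem star_update_zero {d : ℕ → ℂ} (h0 : star (d 0) = d 0) {k : ℕ} (hk : 0 < k) (w : ℂ) :
    star (Function.update d k w 0) = Function.update d k w 0 := by
  rw [Function.update_of_ne hk.ne, h0]

theorem toep_update_mulVec (d : ℕ → ℂ) {k : ℕ} (hk : 0 < k) (w : ℂ) (x : Fin (k + 1) → ℂ) :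
    toep (Function.update d k w) (k + 1) *ᵥ x =
      toep (Function.update d k 0) (k + 1) *ᵥ x + Pi.single (Fin.last k) (w * x 0) +
        Pi.single 0 (star w * x (Fin.last k)) := by
  have h : toep (Function.update d k w) (k + 1) = toep (Function.update d k 0) (k + 1) +
      Matrix.single (Fin.last k) 0 w + Matrix.single 0 (Fin.last k) (star w) := by
    ext i j
    simp only [toep, toeplitz, Matrix.of_apply, Matrix.add_apply, Matrix.single_apply,
      Function.update_apply, Fin.ext_iff, Fin.val_last, Fin.val_zero, Fin.le_def]
    have hi := i.2
    have hj := j.2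
    by_cases h1 : (j : ℕ) ≤ i
    · have h2 : ¬ (0 = (i : ℕ) ∧ k = j) := by omega
      by_cases h3 : (i : ℕ) - j = k
      · have h4 : k = (i : ℕ) ∧ 0 = (j : ℕ) := by omega
        simp only [if_pos h1, if_neg h2, if_pos h3, if_pos h4]
        ring
      · have h4 : ¬ (k = (i : ℕ) ∧ 0 = (j : ℕ)) := by omega
        simp only [if_pos h1, if_neg h2, if_neg h3, if_neg h4]
        ring
    · have h2 : ¬ (k = (i : ℕ) ∧ 0 = (j : ℕ)) := by omega
      by_cases h3 : (j : ℕ) - i = k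
      · have h4 : 0 = (i : ℕ) ∧ k = (j : ℕ) := by omega
        simp only [if_neg h1, if_neg h2, if_pos h3, if_pos h4, star_zero]
        ring
      · have h4 : ¬ (0 = (i : ℕ) ∧ k = (j : ℕ)) := by omega
        simp only [if_neg h1, if_neg h2, if_neg h3, if_neg h4]
        ring
  rw [h, add_mulVec, add_mulVec]
  congr 1
  · congr 1
    ext i
    simp [Matrix.single_mulVec, Pi.single_apply, Function.update_apply]
  · ext i
    simp [Matrix.single_mulVec, Pi.single_apply, Function.update_apply]

theorem star_dotProduct_mulVec_comm {k : ℕ} {B : Matrix (Fin k) (Fin k) ℂ} (hB : B.IsHermitian)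
    (x y : Fin k → ℂ) : star x ⬝ᵥ B *ᵥ y = star (B *ᵥ x) ⬝ᵥ y := by
  rw [dotProduct_mulVec, star_mulVec, hB.eq]

/-- The Schur complement of a nondegenerate Toeplitz matrix in its one-step extension, as a
function of the new entry. -/
theorem exists_schur_vectors {d : ℕ → ℂ} (h0 : star (d 0) = d 0) {k : ℕ} (hk : 0 < k)
    (hd : dimKer (toep d k) = 0) :
    ∃ (g v : ℝ) (η : ℂ), g * v = 1 - Complex.normSq η ∧ ∀ w : ℂ, ∃ u : Fin (k + 1) → ℂ,
      u (Fin.last k) = 1 ∧ toep (Function.update d k w) (k + 1) *ᵥ u =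
        Pi.single (Fin.last k) ((g - 2 * (star w * η).re - v * Complex.normSq w : ℝ) : ℂ) := by
  set d₀ := Function.update d k 0 with hd₀
  have h00 : star (d₀ 0) = d₀ 0 := star_update_zero h0 hk 0
  set B := toep d₀ (k + 1) with hBdef
  have hB : B.IsHermitian := toep_isHermitian h00 (k + 1)
  have hA : toep d₀ k = toep d k := toep_congr fun i hi => Function.update_of_ne hi.ne _ _
  have hdet : IsUnit (toep d₀ k) := by
    rw [Matrix.isUnit_iff_isUnit_det, isUnit_iff_ne_zero, Ne, det_eq_zero_iff_dimKer_pos, hA, hd]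
    exact lt_irrefl _
  have hsurj := Matrix.mulVec_surjective_iff_isUnit.2 hdet
  have hlast0 : Fin.last k ≠ 0 := by
    simpa [Fin.ext_iff] using hk.ne'
  have hsub : ∀ (x : Fin (k + 1) → ℂ) (i : Fin k), (B *ᵥ x) i.castSucc =
      (toep d₀ k *ᵥ (x ∘ Fin.castSucc)) i + B i.castSucc (Fin.last k) * x (Fin.last k) := by
    intro x i
    rw [← toep_submatrix]
    simp [mulVec, dotProduct, Fin.sum_univ_castSucc, hBdef]
  obtain ⟨x, hx⟩ := hsurj fun i => - B i.castSucc (Fin.last k)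
  -- The first column of the inverse; `V` below pads it by a zero and `Y` is its conjugate reversal
  -- in order `k + 1`.
  obtain ⟨v, hv⟩ := hsurj (Pi.single ⟨0, hk⟩ 1)
  set u : Fin (k + 1) → ℂ := Fin.snoc (α := fun _ => ℂ) x 1
  have hul : u (Fin.last k) = 1 := Fin.snoc_last _ _
  have hBu : B *ᵥ u = Pi.single (Fin.last k) ((B *ᵥ u) (Fin.last k)) := by
    ext i
    refine Fin.lastCases (by simp) (fun i => ?_) i
    have hux : u ∘ Fin.castSucc = x := by
      ext i
      simp [u]
    rw [hsub, hux, hx, hul]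
    simp
  set G := (B *ᵥ u) (Fin.last k)
  have hG : star G = G := by
    have h1 : star u ⬝ᵥ B *ᵥ u = G := by simp [hBu, hul]
    have h2 : star (B *ᵥ u) ⬝ᵥ u = star G := by
      rw [hBu, ← Pi.single_star]
      simp [hul]
    exact h2.symm.trans ((star_dotProduct_mulVec_comm hB u u).symm.trans h1)
  set X : ℤ → ℂ := padInt k v
  have hX : ∀ i : ℤ, ¬ (0 ≤ i ∧ i < k) → X i = 0 := fun i => padInt_of_not v
  have hXc : ∀ i : Fin k, conv d₀ X ((i : ℕ) : ℤ) = Pi.single (M := fun _ => ℂ) ⟨0, hk⟩ 1 i := by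
    intro i
    rw [← toep_mulVec d₀ hX, ← hv]
    simp [X]
  have hX1 : ∀ i : ℤ, ¬ (0 ≤ i ∧ i < (k + 1 : ℕ)) → X i = 0 := fun i hi =>
    hX i (by push_cast at hi; omega)
  set V : Fin (k + 1) → ℂ := fun i => X ((i : ℕ) : ℤ)
  set η := conv d₀ X k
  have hVl : V (Fin.last k) = 0 := hX _ (by simp)
  have hBV : B *ᵥ V = Pi.single 0 1 + Pi.single (Fin.last k) η := by
    ext j
    rw [toep_mulVec d₀ hX1]
    refine Fin.lastCases ?_ (fun i => ?_) j
    · simp [hlast0, η]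
    · rw [Fin.val_castSucc, hXc]
      simp only [Pi.single_apply, Fin.ext_iff, Pi.add_apply, Fin.val_castSucc, Fin.val_zero,
        Fin.val_last, if_neg i.2.ne, add_zero]
  set Y : ℤ → ℂ := fun i => star (X (k - i))
  have hY : ∀ i : ℤ, ¬ (0 ≤ i ∧ i < (k + 1 : ℕ)) → Y i = 0 := fun i hi => by
    simp only [Y]
    rw [hX _ (by push_cast at hi; omega), star_zero]
  have hBY : B *ᵥ (fun i => Y ((i : ℕ) : ℤ)) =
      Pi.single 0 (star η) + Pi.single (Fin.last k) 1 := by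
    ext j
    rw [toep_mulVec d₀ hY, conv_reverse h00]
    by_cases hj : j = 0
    · subst hj
      simp [hlast0.symm, η]
    · have hj1 : 0 < (j : ℕ) := Nat.pos_of_ne_zero fun h => hj (Fin.ext h)
      have hj2 := j.2
      have h1 := hXc ⟨k - j, by omega⟩
      rw [show (((⟨k - j, by omega⟩ : Fin k) : ℕ) : ℤ) = (k : ℤ) - ((j : ℕ) : ℤ) by
        simp only; omega] at h1
      rw [h1]
      by_cases hjl : j = Fin.last k
      · subst hjl
        simp [hlast0]
      · have : k - (j : ℕ) ≠ 0 := fun h => hjl (Fin.ext (by simp; omega))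
        simp [hj, hjl, Fin.ext_iff, this]
  -- Pairing `V` with `u` gives `u 0`; pairing `u` with `Y` then gives the relation between `G` and
  -- `V 0`.
  have hu0 : u 0 = - star η := by
    have h1 := star_dotProduct_mulVec_comm hB V u
    rw [hBu, hBV] at h1
    simp only [star_add, ← Pi.single_star, add_dotProduct, single_dotProduct, dotProduct_single,
      Pi.star_apply, hVl, hul, star_one, star_zero] at h1
    linear_combination -h1
  have hV0 : star (V 0) = V 0 := by
    have h1 := star_dotProduct_mulVec_comm hB V V
    rw [hBV] at h1
    simp only [star_add, ← Pi.single_star, add_dotProduct, dotProduct_add, single_dotProduct,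
      dotProduct_single, Pi.star_apply, hVl, star_one, star_zero] at h1
    linear_combination h1
  have hGV : G * V 0 = 1 - η * star η := by
    have h1 := star_dotProduct_mulVec_comm hB u (fun i => Y ((i : ℕ) : ℤ))
    rw [hBu, hBY] at h1
    simp only [← Pi.single_star, dotProduct_add, single_dotProduct,
      dotProduct_single, Pi.star_apply, hul, hu0, star_one, star_neg, star_star, hG] at h1
    have h2 : Y ((Fin.last k : ℕ) : ℤ) = V 0 := by
      simp only [Y, V, Fin.val_last, sub_self, Fin.val_zero, Nat.cast_zero]
      exact hV0
    rw [h2] at h1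
    linear_combination -h1
  have hGre : ((G.re : ℝ) : ℂ) = G := Complex.conj_eq_iff_re.1 hG
  have hVre : (((V 0).re : ℝ) : ℂ) = V 0 := Complex.conj_eq_iff_re.1 hV0
  -- The entry `star w` in the corner adds `star w` to the first coordinate of the image of `u`;
  -- subtracting `star w • V` cancels it.
  refine ⟨G.re, (V 0).re, η, ?_, fun w => ⟨u - star w • V, by simp [hul, hVl], ?_⟩⟩
  · have h3 : η * star η = ((Complex.normSq η : ℝ) : ℂ) := Complex.mul_conj η
    rw [← hGre, ← hVre, h3] at hGV
    exact_mod_cast hGV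
  · rw [toep_update_mulVec d hk, ← hd₀, ← hBdef, mulVec_sub, mulVec_smul, hBu, hBV]
    have h4 : ((2 * (star w * η).re : ℝ) : ℂ) = star w * η + w * star η := by
      rw [← Complex.add_conj]
      simp
    have h5 : ((Complex.normSq w : ℝ) : ℂ) = w * star w := (Complex.mul_conj w).symm
    ext i
    by_cases hi : i = 0
    · subst hi
      simp [hlast0.symm, hul, hVl]
    · by_cases hil : i = Fin.last k
      · subst hil
        rw [Complex.ofReal_sub, Complex.ofReal_sub, h4, Complex.ofReal_mul, h5, hGre, hVre]
        simp only [Pi.add_apply, Pi.sub_apply, Pi.smul_apply, Pi.single_eq_same, hu0,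
          Pi.single_eq_of_ne hlast0, smul_eq_mul]
        ring
      · simp [hi, hil]

/-- For `v ≠ 0`, multiplication by `v` turns the equation into `|v w + η|² = 1 - t v`, a circle of
positive radius, of which a quarter is parametrized. For `v = 0` one has `|η| = 1`, and the equation
describes a line. -/
theorem infinite_level_set {g v : ℝ} {η : ℂ} (h : g * v = 1 - Complex.normSq η) {t : ℝ}
    (ht : 0 < 1 - t * v) :
    {w : ℂ | g - 2 * (star w * η).re - v * Complex.normSq w = t}.Infinite := by
  by_cases hv : v = 0
  · subst hv
    have hη : Complex.normSq η = 1 := by linarith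
    refine Set.infinite_of_injective_forall_mem
      (f := fun r : ℝ => η * (((g - t) / 2 : ℝ) + r * Complex.I)) (fun r s hrs => ?_) fun r => ?_
    · have hη0 : η ≠ 0 := by
        rintro rfl
        simp at hη
      simpa [hη0] using hrs
    · rw [Complex.normSq_apply] at hη
      simp
      linear_combination (t - g) * hη
  · set σ := Real.sqrt (1 - t * v)
    have hσ : σ ^ 2 = 1 - t * v := Real.sq_sqrt ht.le
    have hσ0 : σ ≠ 0 := (Real.sqrt_pos.2 ht).ne'
    refine Set.infinite_of_injOn_mapsTo
      (f := fun r : ℝ => (⟨(σ * r - η.re) / v, (σ * Real.sqrt (1 - r ^ 2) - η.im) / v⟩ : ℂ))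
      (s := Set.Icc 0 1) (fun r _ s _ hrs => ?_) (fun r hr => ?_) (Set.Icc_infinite one_pos)
    · have := congrArg Complex.re hrs
      simp only at this
      field_simp at this
      simpa [hσ0] using this
    · have h1 : Real.sqrt (1 - r ^ 2) ^ 2 = 1 - r ^ 2 :=
        Real.sq_sqrt (by nlinarith [hr.1, hr.2])
      rw [Complex.normSq_apply] at h
      simp only [Set.mem_ofPred_eq, Complex.normSq_apply, Complex.mul_re, Complex.star_def,
        Complex.conj_re, Complex.conj_im]
      set ρ := Real.sqrt (1 - r ^ 2)
      refine mul_left_cancel₀ hv ?_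
      field_simp
      linear_combination h - σ ^ 2 * h1 - hσ

theorem infinite_dimKer_pos {d : ℕ → ℂ} (h0 : star (d 0) = d 0) {k : ℕ} (hk : 0 < k)
    (hd : dimKer (toep d k) = 0) :
    {w : ℂ | 0 < dimKer (toep (Function.update d k w) (k + 1))}.Infinite := by
  obtain ⟨g, v, η, hgv, hu⟩ := exists_schur_vectors h0 hk hd
  refine (infinite_level_set hgv (t := 0) (by norm_num)).mono fun w hw => ?_
  obtain ⟨u, hul, hBu⟩ := hu w
  rw [Set.mem_ofPred_eq] at hw
  rw [hw] at hBu
  rw [Set.mem_ofPred_eq, ← det_eq_zero_iff_dimKer_pos, ← Matrix.exists_mulVec_eq_zero_iff]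
  refine ⟨u, fun h => ?_, by simpa using hBu⟩
  rw [h] at hul
  simp at hul

theorem exists_update_signIndex {d : ℕ → ℂ} (h0 : star (d 0) = d 0) {k : ℕ} (hk : 0 < k)
    (hd : dimKer (toep d k) = 0) {s : ℝ} (hs : s ≠ 0) :
    ∃ w : ℂ, signIndex (toep_isHermitian h0 k) s + 1 ≤
      signIndex (toep_isHermitian (star_update_zero h0 hk w) (k + 1)) s := by
  obtain ⟨g, v, η, hgv, hu⟩ := exists_schur_vectors h0 hk hd
  obtain ⟨t, hst, ht⟩ : ∃ t, 0 < s * t ∧ 0 < 1 - t * v := by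
    -- A value of the sign of `s`, small enough that `t * v < 1` for either sign of `v`.
    refine ⟨s / (1 + (s * v) ^ 2), ?_, ?_⟩
    · rw [← mul_div_assoc]
      exact div_pos (mul_self_pos.2 hs) (by positivity)
    · rw [div_mul_eq_mul_div, sub_pos, div_lt_one (by positivity)]
      nlinarith [sq_nonneg (s * v - 1)]
  obtain ⟨w, hw⟩ := (infinite_level_set hgv ht).nonempty
  obtain ⟨u, hul, hBu⟩ := hu w
  rw [Set.mem_ofPred_eq] at hw
  rw [hw] at hBu
  have hsub : (toep (Function.update d k w) (k + 1)).submatrix Fin.castSucc Fin.castSucc =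
      toep d k :=
    (toep_submatrix _ k).trans (toep_congr fun i hi => Function.update_of_ne hi.ne _ _)
  have hA : ((toep (Function.update d k w) (k + 1)).submatrix
      Fin.castSucc Fin.castSucc).IsHermitian := by
    rw [hsub]
    exact toep_isHermitian h0 k
  have e : signIndex hA s = signIndex (toep_isHermitian h0 k) s := by
    congr 1
  refine ⟨w, ?_⟩
  rw [← e]
  exact signIndex_submatrix_add_one_le _ hA s u hul t hBu hst

theorem exists_update_posIndex {d : ℕ → ℂ} (h0 : star (d 0) = d 0) {k : ℕ} (hk : 0 < k)
    (hd : dimKer (toep d k) = 0) :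
    ∃ w : ℂ, dimKer (toep (Function.update d k w) (k + 1)) = 0 ∧
      negIndex (toep (Function.update d k w) (k + 1)) = negIndex (toep d k) ∧
      posIndex (toep (Function.update d k w) (k + 1)) = posIndex (toep d k) + 1 := by
  obtain ⟨w, hw⟩ := exists_update_signIndex h0 hk hd one_ne_zero
  rw [signIndex_one, signIndex_one] at hw
  have h0' := star_update_zero h0 hk w
  have h1 := negIndex_add_posIndex_add_dimKer h0 k
  have h2 := negIndex_add_posIndex_add_dimKer h0' (k + 1)
  have h3 := negIndex_toep_succ h0' k
  rw [toep_congr fun i hi => Function.update_of_ne (f := d) (ne_of_lt hi) w] at h3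
  exact ⟨w, by omega⟩

theorem exists_update_negIndex {d : ℕ → ℂ} (h0 : star (d 0) = d 0) {k : ℕ} (hk : 0 < k)
    (hd : dimKer (toep d k) = 0) :
    ∃ w : ℂ, dimKer (toep (Function.update d k w) (k + 1)) = 0 ∧
      negIndex (toep (Function.update d k w) (k + 1)) = negIndex (toep d k) + 1 ∧
      posIndex (toep (Function.update d k w) (k + 1)) = posIndex (toep d k) := by
  obtain ⟨w, hw⟩ := exists_update_signIndex h0 hk hd (neg_ne_zero.2 one_ne_zero)
  rw [signIndex_neg_one, signIndex_neg_one] at hw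
  have h0' := star_update_zero h0 hk w
  have h1 := negIndex_add_posIndex_add_dimKer h0 k
  have h2 := negIndex_add_posIndex_add_dimKer h0' (k + 1)
  have h3 := posIndex_toep_succ h0' k
  rw [toep_congr fun i hi => Function.update_of_ne (f := d) (ne_of_lt hi) w] at h3
  exact ⟨w, by omega⟩

/-! ### Growing kernels and linear recurrences -/

/-- For `k ≥ m + 1` no conjugated entries occur, so vanishing of the convolution is a linear
recurrence for `d k` with leading coefficient `p 0`. -/
theorem conv_natCast_eq (d : ℕ → ℂ) {m k : ℕ} (hk : m + 1 ≤ k) {p : ℤ → ℂ}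
    (hp : ∀ i : ℤ, ¬ (0 ≤ i ∧ i < (m + 1 : ℕ)) → p i = 0) :
    conv d p k = d k * p 0 + ∑ i : Fin m, d (k - (i + 1)) * p ((i : ℕ) + 1) := by
  rw [conv_eq_sum d hp, Fin.sum_univ_succ]
  congr 1
  refine Finset.sum_congr rfl fun i _ => ?_
  have := i.2
  have h : (0 : ℤ) ≤ (k : ℤ) - ((i.succ : ℕ) : ℤ) := by
    simp only [Fin.val_succ]
    omega
  rw [herm, if_pos h]
  congr 2
  simp only [Fin.val_succ]
  omega

/-- The continuation of `d` from the index `m + 1` on by the linear recurrence with coefficients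
`p`. -/
noncomputable def recurrenceExtension (d : ℕ → ℂ) (m : ℕ) (p : ℤ → ℂ) (k : ℕ) : ℂ :=
  if k < m + 1 then d k
  else -(∑ i : Fin m, recurrenceExtension d m p (k - (i + 1)) * p ((i : ℕ) + 1)) / p 0
termination_by k

theorem kerToep_congr {d d' : ℕ → ℂ} {k : ℕ} (h : ∀ i < k, d' i = d i) :
    kerToep d' k = kerToep d k := by
  rw [kerToep, kerToep, toep_congr h]

/-- In the regular case some extension has a growing kernel. -/
theorem exists_growing_extension {d : ℕ → ℂ} (h0 : star (d 0) = d 0) {n : ℕ} (hn : 0 < n)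
    {p : ℤ → ℂ} (hp : p ∈ kerToep d n) (hp0 : p 0 ≠ 0) :
    ∃ d' : ℕ → ℂ, (∀ i < n, d' i = d i) ∧
      ∀ k ≥ n, dimKer (toep d' k) < dimKer (toep d' (k + 1)) := by
  obtain ⟨m, rfl⟩ : ∃ m, n = m + 1 := ⟨n - 1, by omega⟩
  set d' := recurrenceExtension d m p
  have hag : ∀ i < m + 1, d' i = d i := fun i hi => by
    simp only [d']
    rw [recurrenceExtension, if_pos hi]
  have h0' : star (d' 0) = d' 0 := by rw [hag 0 hn, h0]
  have hconv : ∀ k ≥ m + 1, conv d' p k = 0 := fun k hk => by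
    rw [conv_natCast_eq d' hk (kerToep_support hp)]
    have : d' k = -(∑ i : Fin m, d' (k - (i + 1)) * p ((i : ℕ) + 1)) / p 0 := by
      simp only [d']
      rw [recurrenceExtension, if_neg (by omega)]
    rw [this]
    field_simp
    ring
  have hmem : ∀ k ≥ m + 1, p ∈ kerToep d' k := fun k hk => by
    induction k, hk using Nat.le_induction with
    | base => rwa [kerToep_congr hag]
    | succ k hk ih => exact (lt_dimKer_of_conv_eq_zero h0' ih hp0 (hconv k hk)).2
  exact ⟨d', hag, fun k hk => (lt_dimKer_of_conv_eq_zero h0' (hmem k hk) hp0 (hconv k hk)).1⟩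

/-- An extension with a growing kernel is unique. -/
theorem growing_extension_unique {d d' : ℕ → ℂ} (h0 : star (d 0) = d 0) {n : ℕ} (hn : 0 < n)
    {p : ℤ → ℂ} (hp : p ∈ kerToep d n) (hp0 : p 0 ≠ 0) (hag : ∀ i < n, d' i = d i)
    (hd : ∀ k ≥ n, dimKer (toep d k) < dimKer (toep d (k + 1)))
    (hd' : ∀ k ≥ n, dimKer (toep d' k) < dimKer (toep d' (k + 1))) : d' = d := by
  obtain ⟨m, rfl⟩ : ∃ m, n = m + 1 := ⟨n - 1, by omega⟩
  have key : ∀ e : ℕ → ℂ, star (e 0) = e 0 → p ∈ kerToep e (m + 1) →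
      (∀ k ≥ m + 1, dimKer (toep e k) < dimKer (toep e (k + 1))) →
      ∀ k ≥ m + 1, conv e p k = 0 := by
    intro e he0 hpe he k hk
    have hgrow : ∀ k ≥ m + 1, (∀ x ∈ kerToep e k, conv e x k = 0) ∧
        kerToep e k ≤ kerToep e (k + 1) := fun k hk =>
      (kerToep_le_or_lt he0 k).resolve_right fun h =>
        (dimKer_lt_of_exists he0 h.1).not_gt (he k hk)
    have hmem : ∀ k ≥ m + 1, p ∈ kerToep e k := fun k hk => by
      induction k, hk using Nat.le_induction with
      | base => exact hpe
      | succ k hk ih => exact (hgrow k hk).2 ih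
    exact (hgrow k hk).1 p (hmem k hk)
  have h1 := key d h0 hp hd
  have h2 := key d' (by rw [hag 0 hn, h0]) (by rwa [kerToep_congr hag]) hd'
  ext k
  induction k using Nat.strong_induction_on with
  | _ k ih =>
    by_cases hk : k < m + 1
    · exact hag k hk
    · push Not at hk
      have h3 := h1 k hk
      have h4 := h2 k hk
      rw [conv_natCast_eq _ hk (kerToep_support hp)] at h3 h4
      have h5 : ∑ i : Fin m, d' (k - (i + 1)) * p ((i : ℕ) + 1) =
          ∑ i : Fin m, d (k - (i + 1)) * p ((i : ℕ) + 1) :=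
        Finset.sum_congr rfl fun i _ => by rw [ih _ (by omega)]
      rw [h5] at h4
      refine mul_right_cancel₀ hp0 ?_
      linear_combination h4 - h3

theorem inertia_of_growing {d : ℕ → ℂ} (h0 : star (d 0) = d 0) {n : ℕ}
    (h : ∀ k ≥ n, dimKer (toep d k) < dimKer (toep d (k + 1))) (k : ℕ) (hk : n ≤ k) :
    negIndex (toep d k) = negIndex (toep d n) ∧ posIndex (toep d k) = posIndex (toep d n) := by
  induction k, hk using Nat.le_induction with
  | base => exact ⟨rfl, rfl⟩
  | succ k hk ih =>
    have := inertia_of_lt_dimKer h0 (h k hk)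
    omega

/-- Either the kernel grows forever, or both indices grow by at least the dimension of the
kernel. -/
theorem growing_or_le_index {d : ℕ → ℂ} (h0 : star (d 0) = d 0) {n : ℕ}
    (hn : 0 < dimKer (toep d n)) :
    (∀ k ≥ n, dimKer (toep d k) < dimKer (toep d (k + 1))) ∨
      ∃ K, ∀ k ≥ K, negIndex (toep d n) + dimKer (toep d n) ≤ negIndex (toep d k) ∧
        posIndex (toep d n) + dimKer (toep d n) ≤ posIndex (toep d k) := by
  by_contra! hcon
  obtain ⟨⟨k, hk, hkle⟩, h2⟩ := hcon
  have hgrow : ∀ k ≥ n, dimKer (toep d n) ≤ dimKer (toep d k) ∧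
      dimKer (toep d k) < dimKer (toep d (k + 1)) := by
    intro k hk
    -- A drop at `k` continues to nullity zero and adds `dimKer (toep d k)`, hence at least `dimKer
    -- (toep d n)`, to both indices, contrary to `h2`.
    have hstep : ∀ k ≥ n, dimKer (toep d n) ≤ dimKer (toep d k) →
        dimKer (toep d k) < dimKer (toep d (k + 1)) := by
      intro k hk hle
      refine (dimKer_lt_or_lt h0 (by omega)).resolve_left fun hlt => ?_
      have h3 := inertia_of_shrinking h0 hlt _ le_rfl
      obtain ⟨l, hl, h4⟩ := h2 (k + dimKer (toep d k))
      have h5 := negIndex_toep_mono h0 hl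
      have h6 := posIndex_toep_mono h0 hl
      have h7 := negIndex_toep_mono h0 hk
      have h8 := posIndex_toep_mono h0 hk
      dsimp only at h5 h6 h7 h8
      have := h4 (by omega)
      omega
    induction k, hk using Nat.le_induction with
    | base => exact ⟨le_rfl, hstep n le_rfl le_rfl⟩
    | succ k hk ih => exact ⟨by omega, hstep (k + 1) (by omega) (by omega)⟩
  exact (hgrow k hk).2.not_ge hkle

/-! ### Extensions with prescribed inertia -/

theorem mem_classP₂_of_forall {d : ℕ → ℂ} (h0 : star (d 0) = d 0) {n ν π : ℕ}
    (h : ∀ k ≥ n, negIndex (toep d k) = ν ∧ posIndex (toep d k) = π) : d ∈ classP₂ ν π :=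
  ⟨h0, Filter.eventually_atTop.2 ⟨n, fun r hr => h (r + 1) (by omega)⟩⟩

theorem classP₂_subset_classP (ν π : ℕ) : classP₂ ν π ⊆ classP ν := fun _ h =>
  ⟨h.1, h.2.mono fun _ h => h.1⟩

/-- A nondegenerate section has infinitely many extensions with prescribed larger inertia. -/
theorem infinite_extensions (ν π : ℕ) : ∀ {d : ℕ → ℂ} (_ : star (d 0) = d 0) {n : ℕ} (_ : 0 < n)
    (_ : dimKer (toep d n) = 0),
    {d' : ℕ → ℂ | (∀ i < n, d' i = d i) ∧
      d' ∈ classP₂ (negIndex (toep d n) + ν) (posIndex (toep d n) + π)}.Infinite := by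
  induction ν with
  | zero =>
    induction π with
    | zero =>
      intro d h0 n hn hd
      have key : ∀ w ∈ {w : ℂ | 0 < dimKer (toep (Function.update d n w) (n + 1))},
          ∃ d' : ℕ → ℂ, d' n = w ∧ (∀ i < n, d' i = d i) ∧
            d' ∈ classP₂ (negIndex (toep d n)) (posIndex (toep d n)) := by
        intro w hw
        rw [Set.mem_ofPred_eq] at hw
        have h0' := star_update_zero h0 hn w
        have hT : toep (Function.update d n w) n = toep d n :=
          toep_congr fun i hi => Function.update_of_ne hi.ne _ _
        have h1 := inertia_of_lt_dimKer h0' (k := n) (by rw [hT, hd]; exact hw)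
        rw [hT, hd] at h1
        -- The singular matrix of order `n + 1` has rank `n` and a nondegenerate section of order
        -- `n`, so its kernel supplies a recurrence.
        obtain ⟨p, hp, hp0⟩ := exists_mem_kerToep_of_regular h0' (ρ := n) (by rw [hT, hd]) hw
          (by omega)
        obtain ⟨d', hag, hgrow⟩ := exists_growing_extension h0' (n := n + 1) (by omega) hp hp0
        have h0'' : star (d' 0) = d' 0 := by rw [hag 0 (by omega), h0']
        refine ⟨d', by rw [hag n (by omega), Function.update_self], fun i hi => ?_, ?_⟩
        · rw [hag i (by omega), Function.update_of_ne hi.ne]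
        · refine mem_classP₂_of_forall h0'' (n := n + 1) fun k hk => ?_
          have h2 := inertia_of_growing h0'' hgrow k hk
          rw [toep_congr hag] at h2
          omega
      choose! F hF using key
      refine Set.infinite_of_injOn_mapsTo (f := F) (fun w hw w' hw' h => ?_)
        (fun w hw => (hF w hw).2) (infinite_dimKer_pos h0 hn hd)
      rw [← (hF w hw).1, h, (hF w' hw').1]
    | succ π ih =>
      intro d h0 n hn hd
      obtain ⟨w, h1, h2, h3⟩ := exists_update_posIndex h0 hn hd
      refine (ih (star_update_zero h0 hn w) (Nat.succ_pos n) h1).mono fun d' hd' => ⟨?_, ?_⟩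
      · intro i hi
        rw [hd'.1 i (by omega), Function.update_of_ne hi.ne]
      · have := hd'.2
        rwa [h2, h3, add_right_comm, add_assoc] at this
  | succ ν ih =>
    intro d h0 n hn hd
    obtain ⟨w, h1, h2, h3⟩ := exists_update_negIndex h0 hn hd
    refine (ih (star_update_zero h0 hn w) (Nat.succ_pos n) h1).mono fun d' hd' => ⟨?_, ?_⟩
    · intro i hi
      rw [hd'.1 i (by omega), Function.update_of_ne hi.ne]
    · have := hd'.2
      rwa [h2, h3, add_right_comm, add_assoc] at this

/-- After a step that shrinks the kernel, all sufficiently large inertias are attained. -/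
theorem infinite_extensions_of_dimKer_lt {d : ℕ → ℂ} (h0 : star (d 0) = d 0) {n : ℕ} (hn : 0 < n)
    (hd : dimKer (toep d (n + 1)) < dimKer (toep d n)) {ν π : ℕ}
    (hν : negIndex (toep d n) + dimKer (toep d n) ≤ ν)
    (hπ : posIndex (toep d n) + dimKer (toep d n) ≤ π) :
    {d' : ℕ → ℂ | (∀ i < n, d' i = d i) ∧ d' ∈ classP₂ ν π}.Infinite := by
  obtain ⟨h1, h2, h3⟩ := inertia_of_shrinking h0 hd _ le_rfl
  obtain ⟨a, rfl⟩ := Nat.exists_eq_add_of_le hν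
  obtain ⟨b, rfl⟩ := Nat.exists_eq_add_of_le hπ
  have := infinite_extensions a b h0 (n := n + dimKer (toep d n)) (by omega) (by omega)
  rw [h2, h3] at this
  exact this.mono fun d' hd' => ⟨fun i hi => hd'.1 i (by omega), hd'.2⟩

theorem exists_index_eq_of_mem_classP {d : ℕ → ℂ} {ν : ℕ} (h : d ∈ classP ν) (K : ℕ) :
    ∃ k ≥ K, negIndex (toep d k) = ν := by
  obtain ⟨R, hR⟩ := Filter.eventually_atTop.1 h.2
  exact ⟨max R K + 1, by omega, hR (max R K) (le_max_left _ _)⟩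

theorem exists_index_eq_of_mem_classP₂ {d : ℕ → ℂ} {ν π : ℕ} (h : d ∈ classP₂ ν π) (K : ℕ) :
    ∃ k ≥ K, negIndex (toep d k) = ν ∧ posIndex (toep d k) = π := by
  obtain ⟨R, hR⟩ := Filter.eventually_atTop.1 h.2
  exact ⟨max R K + 1, by omega, hR (max R K) (le_max_left _ _)⟩

/-! ### The two degenerate cases -/

theorem regular_case {d : ℕ → ℂ} (h0 : star (d 0) = d 0) {n ρ : ℕ} (hn : 0 < n)
    (hker : 0 < dimKer (toep d n)) (hreg : dimKer (toep d ρ) = 0)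
    (hρ : ρ + dimKer (toep d n) = n) :
    (∃ e : ℕ → ℂ,
      {d' : ℕ → ℂ | ∀ i < n, d' i = d i} ∩ classP (negIndex (toep d n)) = {e} ∧
        e ∈ classP₂ (negIndex (toep d n)) (posIndex (toep d n))) ∧
    ((∀ ν : ℕ, negIndex (toep d n) < ν → ν < negIndex (toep d n) + dimKer (toep d n) →
        {d' : ℕ → ℂ | ∀ i < n, d' i = d i} ∩ classP ν = ∅) ∧
      (∀ ν π : ℕ,
        (negIndex (toep d n) < ν ∧ ν < negIndex (toep d n) + dimKer (toep d n)) ∨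
          (posIndex (toep d n) < π ∧ π < posIndex (toep d n) + dimKer (toep d n)) →
        {d' : ℕ → ℂ | ∀ i < n, d' i = d i} ∩ classP₂ ν π = ∅)) ∧
    (∀ ν π : ℕ, negIndex (toep d n) + dimKer (toep d n) ≤ ν →
      posIndex (toep d n) + dimKer (toep d n) ≤ π →
      ({d' : ℕ → ℂ | ∀ i < n, d' i = d i} ∩ classP₂ ν π).Infinite) := by
  obtain ⟨p, hp, hp0⟩ := exists_mem_kerToep_of_regular h0 hreg hker hρ
  have hdich : ∀ d' : ℕ → ℂ, star (d' 0) = d' 0 → (∀ i < n, d' i = d i) →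
      (∀ k ≥ n, dimKer (toep d' k) < dimKer (toep d' (k + 1))) ∧
        (∀ k ≥ n, negIndex (toep d' k) = negIndex (toep d n) ∧
          posIndex (toep d' k) = posIndex (toep d n)) ∨
      ∃ K, ∀ k ≥ K, negIndex (toep d n) + dimKer (toep d n) ≤ negIndex (toep d' k) ∧
        posIndex (toep d n) + dimKer (toep d n) ≤ posIndex (toep d' k) := by
    intro d' h0' hag
    have hT : toep d' n = toep d n := toep_congr hag
    have h1 := growing_or_le_index h0' (n := n) (by rwa [hT])
    have h2 := inertia_of_growing h0' (n := n)
    rw [hT] at h1 h2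
    exact h1.imp_left fun h => ⟨h, h2 h⟩
  refine ⟨?_, ⟨fun ν h1 h2 => ?_, fun ν π h => ?_⟩, fun ν π hν hπ => ?_⟩
  · obtain ⟨e, hag, hgrow⟩ := exists_growing_extension h0 hn hp hp0
    have h0' : star (e 0) = e 0 := by rw [hag 0 hn, h0]
    have hmem : e ∈ classP₂ (negIndex (toep d n)) (posIndex (toep d n)) := by
      refine mem_classP₂_of_forall h0' (n := n) fun k hk => ?_
      have := inertia_of_growing h0' hgrow k hk
      rwa [toep_congr hag] at this
    refine ⟨e, Set.eq_singleton_iff_unique_mem.2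
      ⟨⟨hag, classP₂_subset_classP _ _ hmem⟩, fun d' ⟨hag', hP⟩ => ?_⟩, hmem⟩
    rcases hdich d' hP.1 hag' with h | ⟨K, hK⟩
    · refine growing_extension_unique h0' hn (by rwa [kerToep_congr hag]) hp0
        (fun i hi => (hag' i hi).trans (hag i hi).symm) hgrow h.1
    · obtain ⟨k, hk, hk'⟩ := exists_index_eq_of_mem_classP hP K
      have := hK k hk
      omega
  · rw [Set.eq_empty_iff_forall_notMem]
    rintro d' ⟨hag, hP⟩
    rcases hdich d' hP.1 hag with h | ⟨K, hK⟩
    · obtain ⟨k, hk, hk'⟩ := exists_index_eq_of_mem_classP hP n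
      have := h.2 k hk
      omega
    · obtain ⟨k, hk, hk'⟩ := exists_index_eq_of_mem_classP hP K
      have := hK k hk
      omega
  · rw [Set.eq_empty_iff_forall_notMem]
    rintro d' ⟨hag, hP⟩
    rcases hdich d' hP.1 hag with h1 | ⟨K, hK⟩
    · obtain ⟨k, hk, hk'⟩ := exists_index_eq_of_mem_classP₂ hP n
      have := h1.2 k hk
      omega
    · obtain ⟨k, hk, hk'⟩ := exists_index_eq_of_mem_classP₂ hP K
      have := hK k hk
      omega
  -- The convolution at `n` is affine in `w` with slope `p 0 ≠ 0`. A nonzero value makes the kernel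
  -- shrink.
  · obtain ⟨w, hw⟩ : ∃ w : ℂ, conv (Function.update d n w) p n ≠ 0 := by
      obtain ⟨m, rfl⟩ : ∃ m, n = m + 1 := ⟨n - 1, by omega⟩
      by_contra! hcon
      have h1 := hcon 0
      have h2 := hcon 1
      rw [conv_natCast_eq _ le_rfl (kerToep_support hp)] at h1 h2
      simp only [Function.update_self] at h1 h2
      have h3 : ∀ w : ℂ, ∑ i : Fin m, Function.update d (m + 1) w (m + 1 - (i + 1)) *
          p ((i : ℕ) + 1) = ∑ i : Fin m, d (m + 1 - (i + 1)) * p ((i : ℕ) + 1) := fun w =>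
        Finset.sum_congr rfl fun i _ => by rw [Function.update_of_ne (by omega)]
      rw [h3] at h1 h2
      exact hp0 (by linear_combination h2 - h1)
    have hag : ∀ i < n, Function.update d n w i = d i := fun i hi =>
      Function.update_of_ne hi.ne _ _
    have hT : toep (Function.update d n w) n = toep d n := toep_congr hag
    have h0' := star_update_zero h0 hn w
    have hlt := dimKer_lt_of_exists h0' ⟨p, by rwa [kerToep_congr hag], hw⟩
    refine (infinite_extensions_of_dimKer_lt h0' hn hlt (by rwa [hT]) (by rwa [hT])).mono
      fun d' hd' => ⟨fun i hi => (hd'.1 i hi).trans (hag i hi), hd'.2⟩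

theorem singular_case {d : ℕ → ℂ} (h0 : star (d 0) = d 0) {n : ℕ} (hn : 0 < n)
    (hker : 0 < dimKer (toep d n)) (hsing : dimKer (toep d (n - dimKer (toep d n))) ≠ 0) :
    ({d' : ℕ → ℂ | ∀ i < n, d' i = d i} ∩ classP (negIndex (toep d n)) = ∅) ∧
    ((∀ ν : ℕ, ν < negIndex (toep d n) + dimKer (toep d n) →
        {d' : ℕ → ℂ | ∀ i < n, d' i = d i} ∩ classP ν = ∅) ∧
      (∀ ν π : ℕ,
        ν < negIndex (toep d n) + dimKer (toep d n) ∨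
          π < posIndex (toep d n) + dimKer (toep d n) →
        {d' : ℕ → ℂ | ∀ i < n, d' i = d i} ∩ classP₂ ν π = ∅)) ∧
    (∀ ν π : ℕ, negIndex (toep d n) + dimKer (toep d n) ≤ ν →
      posIndex (toep d n) + dimKer (toep d n) ≤ π →
      ({d' : ℕ → ℂ | ∀ i < n, d' i = d i} ∩ classP₂ ν π).Infinite) := by
  have hle : ∀ d' : ℕ → ℂ, star (d' 0) = d' 0 → (∀ i < n, d' i = d i) →
      ∀ k ≥ n + dimKer (toep d n),
        negIndex (toep d n) + dimKer (toep d n) ≤ negIndex (toep d' k) ∧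
          posIndex (toep d n) + dimKer (toep d n) ≤ posIndex (toep d' k) := by
    intro d' h0' hag k hk
    have hT : toep d' n = toep d n := toep_congr hag
    have hT' : toep d' (n - dimKer (toep d n)) = toep d (n - dimKer (toep d n)) :=
      toep_congr fun i hi => hag i (by omega)
    have hlt := dimKer_lt_of_singular h0' (n := n) (by rwa [hT]) (by rwa [hT, hT'])
    have h1 := inertia_of_shrinking h0' hlt _ le_rfl
    rw [hT] at h1
    have h2 := negIndex_toep_mono h0' hk
    have h3 := posIndex_toep_mono h0' hk
    dsimp only at h2 h3
    omega
  have hP : ∀ ν : ℕ, ν < negIndex (toep d n) + dimKer (toep d n) →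
      {d' : ℕ → ℂ | ∀ i < n, d' i = d i} ∩ classP ν = ∅ := by
    intro ν hν
    rw [Set.eq_empty_iff_forall_notMem]
    rintro d' ⟨hag, hP⟩
    obtain ⟨k, hk, hk'⟩ := exists_index_eq_of_mem_classP hP (n + dimKer (toep d n))
    have := hle d' hP.1 hag k hk
    omega
  refine ⟨hP _ (by omega), ⟨hP, fun ν π h => ?_⟩, fun ν π hν hπ => ?_⟩
  · rw [Set.eq_empty_iff_forall_notMem]
    rintro d' ⟨hag, hP⟩
    obtain ⟨k, hk, hk'⟩ := exists_index_eq_of_mem_classP₂ hP (n + dimKer (toep d n))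
    have := hle d' hP.1 hag k hk
    omega
  -- The kernel shrinks whatever the next entry is, so the entries of `d` itself serve.
  · exact infinite_extensions_of_dimKer_lt h0 hn (dimKer_lt_of_singular h0 hker hsing) hν hπ

end TrigMoment

/-! ### Assembly -/

theorem mainTheorem2 (n : ℕ) (hn : 0 < n) (c : Fin n → ℂ)
    (hc : star (c ⟨0, hn⟩) = c ⟨0, hn⟩)
    (M : Matrix (Fin n) (Fin n) ℂ) (hM : M = TrigMoment.toeplitz c) :
    -- the nondegenerate case
    (M.det ≠ 0 →
      -- (a)
      ((TrigMoment.extensions c ∩ TrigMoment.classP (TrigMoment.negIndex M)).Infinite ∧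
        (TrigMoment.extensions c ∩
          TrigMoment.classP₂ (TrigMoment.negIndex M) (TrigMoment.posIndex M)).Infinite) ∧
      -- (b)
      (∀ ν π : ℕ, (TrigMoment.extensions c ∩
          TrigMoment.classP₂ (TrigMoment.negIndex M + ν) (TrigMoment.posIndex M + π)).Infinite)) ∧
    -- the degenerate case with a nonvanishing minor of order equal to the rank
    (M.det = 0 → (TrigMoment.toeplitzAtRank c).det ≠ 0 →
      -- (c)
      (∃ d : ℕ → ℂ,
        TrigMoment.extensions c ∩ TrigMoment.classP (TrigMoment.negIndex M) = {d} ∧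
          d ∈ TrigMoment.classP₂ (TrigMoment.negIndex M) (TrigMoment.posIndex M)) ∧
      -- (d)
      ((∀ ν : ℕ, TrigMoment.negIndex M < ν →
          ν < TrigMoment.negIndex M + TrigMoment.dimKer M →
          TrigMoment.extensions c ∩ TrigMoment.classP ν = ∅) ∧
        (∀ ν π : ℕ,
          (TrigMoment.negIndex M < ν ∧ ν < TrigMoment.negIndex M + TrigMoment.dimKer M) ∨
            (TrigMoment.posIndex M < π ∧ π < TrigMoment.posIndex M + TrigMoment.dimKer M) →
          TrigMoment.extensions c ∩ TrigMoment.classP₂ ν π = ∅)) ∧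
      -- (e)
      (∀ ν π : ℕ, TrigMoment.negIndex M + TrigMoment.dimKer M ≤ ν →
        TrigMoment.posIndex M + TrigMoment.dimKer M ≤ π →
        (TrigMoment.extensions c ∩ TrigMoment.classP₂ ν π).Infinite)) ∧
    -- the degenerate case with a vanishing minor of order equal to the rank
    (M.det = 0 → (TrigMoment.toeplitzAtRank c).det = 0 →
      -- (f)
      (TrigMoment.extensions c ∩ TrigMoment.classP (TrigMoment.negIndex M) = ∅) ∧
      -- (g)
      ((∀ ν : ℕ, ν < TrigMoment.negIndex M + TrigMoment.dimKer M →
          TrigMoment.extensions c ∩ TrigMoment.classP ν = ∅) ∧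
        (∀ ν π : ℕ,
          ν < TrigMoment.negIndex M + TrigMoment.dimKer M ∨
            π < TrigMoment.posIndex M + TrigMoment.dimKer M →
          TrigMoment.extensions c ∩ TrigMoment.classP₂ ν π = ∅)) ∧
      -- (h)
      (∀ ν π : ℕ, TrigMoment.negIndex M + TrigMoment.dimKer M ≤ ν →
        TrigMoment.posIndex M + TrigMoment.dimKer M ≤ π →
        (TrigMoment.extensions c ∩ TrigMoment.classP₂ ν π).Infinite)) := by
  subst hM
  -- The value `0` from index `n` on is arbitrary: the assertions involve only the first `n` entries
  -- of `d`.
  set d : ℕ → ℂ := fun i => if h : i < n then c ⟨i, h⟩ else 0 with hd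
  have hdc : ∀ i : Fin n, d i = c i := fun i => by simp [hd]
  have h0 : star (d 0) = d 0 := by simpa [hd, hn] using hc
  have hM : TrigMoment.toeplitz c = TrigMoment.toep d n := by
    rw [TrigMoment.toep]
    congr 1
    ext i
    exact (hdc i).symm
  have hext : TrigMoment.extensions c = {d' : ℕ → ℂ | ∀ i < n, d' i = d i} := by
    ext d'
    refine ⟨fun h i hi => (h ⟨i, hi⟩).trans (hdc ⟨i, hi⟩).symm, fun h i => ?_⟩
    exact (h i i.2).trans (hdc i)
  have hrank := TrigMoment.rank_add_dimKer (TrigMoment.toeplitz c)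
  have hR : TrigMoment.toeplitzAtRank c = TrigMoment.toep d (TrigMoment.toeplitz c).rank := by
    rw [TrigMoment.toeplitzAtRank, TrigMoment.toep]
    congr 1
    ext i
    exact (hdc _).symm
  rw [hR]
  -- From here on the rank enters only through `hrank`, its sum with the nullity being `n`.
  generalize (TrigMoment.toeplitz c).rank = ρ at hrank
  rw [hM] at hrank ⊢
  rw [hext]
  refine ⟨fun hdet => ?_, fun hdet hreg => ?_, fun hdet hsing => ?_⟩
  · have hker : TrigMoment.dimKer (TrigMoment.toep d n) = 0 := by
      by_contra h
      exact hdet ((TrigMoment.det_eq_zero_iff_dimKer_pos _).2 (Nat.pos_of_ne_zero h))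
    have h1 := fun ν π => TrigMoment.infinite_extensions ν π h0 hn hker
    exact ⟨⟨(h1 0 0).mono fun d' h => ⟨h.1, TrigMoment.classP₂_subset_classP _ _ h.2⟩, h1 0 0⟩, h1⟩
  · rw [TrigMoment.det_eq_zero_iff_dimKer_pos] at hdet
    rw [Ne, TrigMoment.det_eq_zero_iff_dimKer_pos, Nat.pos_iff_ne_zero, not_not] at hreg
    exact TrigMoment.regular_case h0 hn hdet hreg hrank
  · rw [TrigMoment.det_eq_zero_iff_dimKer_pos] at hdet
    rw [TrigMoment.det_eq_zero_iff_dimKer_pos] at hsing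
    have hs : TrigMoment.dimKer (TrigMoment.toep d
        (n - TrigMoment.dimKer (TrigMoment.toep d n))) ≠ 0 := by
      rw [show n - TrigMoment.dimKer (TrigMoment.toep d n) = ρ by omega]
      exact hsing.ne'
    exact TrigMoment.singular_case h0 hn hdet hs
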